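/- **Setting.** Let $\Gamma$ be a finite simple directed graph in which the edges meeting at each vertex are linearly ordered, and let $\tau_{ee'}=-\tau_{e'e}\in\mathbb C$ be given for each pair of edges meeting at a vertex. For spinors $z=(\alpha,\beta),\,w=(\gamma,\delta)\in\mathbb C^2$ put $\check z=(-\bar\beta,\bar\alpha)$, $[z|w\rangle=\langle\check z,w\rangle=\alpha\delta-\beta\gamma$, and $d\mu(z)=\pi^{-2}e^{-\langle z|z\rangle}d^4z$. The spin-network (intertwiner) generating function is $$\mathcal G_\Gamma(\tau)=\int\prod_{e}d\mu(z_e)\prod_{v}\exp\Big(\sum_{e<e'\text{ at }v}\tau_{ee'}\,[z^v_e|z^v_{e'}\rangle\Big),$$ where $z^v_e=z_e$ if $v$ is the source of $e$ and $z^v_e=\check z_e$ if $v$ is its target. Let $\mathcal L$ be the $m\times n$ square lattice with free boundary ($mn$ sites, $E=m(n-1)+n(m-1)$ edges), with the following orientation and ordering. The sites are coloured as a checkerboard and every edge is directed from the sites of one colour (the sources) to those of the other colour (the sinks), so that the orientations alternate along every path. At each source the edges are ordered cyclically starting from a fixed reference direction $r$, and at each sink they are ordered in the opposite rotational sense (counterclockwise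 if the sources are ordered clockwise, and vice versa) starting from a fixed reference direction $s$ perpendicular to $r$. The choice of the source colour, of the rotational sense, and of $r\perp s$ is arbitrary. **Theorem.** Give $\mathcal L$ the homogeneous weights $\tau_{ee'}=iv$ for $e<e'$ and $\tau_{ee'}=-iv$ for $e>e'$, with $v\in\mathbb C$, and write $\mathcal G_{\mathcal L}(iv)$ for the generating function at these weights. The integral defining it converges absolutely for $|v|<\sqrt2-1$, and for every $v$ for which it converges absolutely, $1+\sum_{P\ge1}g_Pv^P\neq0$ and $$\mathcal G_{\mathcal L}(iv)=\Big(1+\sum_{P\ge1}g_P\,v^P\Big)^{-2},$$ where $g_P$ is the number of sets of $P$ edges of $\mathcal L$ that meet every site in an even number of edges (closed even-valent subgraphs). Equivalently, for $v=\tanh K$ with $K=\beta J\in\mathbb R$ such that the integral converges absolutely, $$\mathcal G_{\mathcal L}(iv)=\frac{2^{2mn}}{(1-v^2)^{E}\,Z(v)^2},\qquad Z(v)=\sum_{\sigma:\text{sites}\to\{\pm1\}}\exp\Big(K\sum_{(i,j)}\sigma_i\sigma_j\Big),$$ with $Z$ the zero-field Ising partition function, the inner sum running over nearest-neighbour pairs.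 -/

import Mathlib

open MeasureTheory Finset

noncomputable section

/-! ### Directed graphs with ordered vertices -/

/-- A simple directed graph with vertex set `V` and edge set `E`, together with a linear ordering
of the edges meeting at each vertex.  The ordering at `v` is recorded by ranks. -/
structure OrderedDigraph (V E : Type) where
  /-- the source vertex of an edge -/
  src : E → V
  /-- the target vertex of an edge -/
  tgt : E → V
  /-- the position of an edge in the ordering at a vertex (only used for incident edges) -/
  rank : V → E → ℕ
  src_ne_tgt : ∀ e, src e ≠ tgt e
  simple : ∀ e e', (src e = src e' ∧ tgt e = tgt e') ∨ (src e = tgt e' ∧ tgt e = src e') → e = e'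
  rank_inj : ∀ v e e', (src e = v ∨ tgt e = v) → (src e' = v ∨ tgt e' = v) →
    rank v e = rank v e' → e = e'

namespace OrderedDigraph

variable {V E : Type} (Γ : OrderedDigraph V E)

/-- The edge `e` meets the vertex `v`. -/
def Inc (e : E) (v : V) : Prop := Γ.src e = v ∨ Γ.tgt e = v

/-- `e < e'` in the ordering of the edges at `v`. -/
def LtAt (v : V) (e e' : E) : Prop := Γ.Inc e v ∧ Γ.Inc e' v ∧ Γ.rank v e < Γ.rank v e'

end OrderedDigraph

/-! ### Spinors and the generating function -/

/-- Spinors `(α, β)` in `ℂ²`. -/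
abbrev Spinor : Type := ℂ × ℂ

/-- The conjugate spinor `ž = (-β̄, ᾱ)`. -/
def Spinor.dual (z : Spinor) : Spinor := (-(starRingEnd ℂ) z.2, (starRingEnd ℂ) z.1)

/-- The bracket `[z|w⟩`, the Hermitian product of `ž` with `w`, antilinear in the first slot. -/
def Spinor.bracket (z w : Spinor) : ℂ :=
  (starRingEnd ℂ) z.dual.1 * w.1 + (starRingEnd ℂ) z.dual.2 * w.2

/-- The Gaussian measure `π⁻² exp(-⟨z|z⟩) d⁴z` on spinor space. -/
def spinorMeasure : Measure Spinor :=
  volume.withDensity fun z =>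
    ENNReal.ofReal ((Real.pi ^ 2)⁻¹ * Real.exp (-(‖z.1‖ ^ 2 + ‖z.2‖ ^ 2)))

namespace OrderedDigraph

variable {V E : Type} [Fintype V] [Fintype E] (Γ : OrderedDigraph V E)

open Classical in
/-- The spinor `z^v_e` attached to the edge `e` at its endpoint `v`: `z_e` at the source, the
conjugate spinor at the target. -/
def spinorAt (z : E → Spinor) (v : V) (e : E) : Spinor :=
  if Γ.src e = v then z e else (z e).dual

open Classical in
/-- The product over the vertices of the vertex generating functions
`exp (∑_{e < e'} τ_{ee'} [z^v_e | z^v_e'⟩)`. -/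
def integrand (τ : E → E → ℂ) (z : E → Spinor) : ℂ :=
  ∏ v : V, Complex.exp (∑ e : E, ∑ e' : E,
    if Γ.LtAt v e e' then
      τ e e' * Spinor.bracket (Γ.spinorAt z v e) (Γ.spinorAt z v e')
    else 0)

/-- The Gaussian integral defining the generating function converges absolutely. -/
def Converges (τ : E → E → ℂ) : Prop :=
  Integrable (Γ.integrand τ) (Measure.pi fun _ : E => spinorMeasure)

/-- The spin network generating function `𝒢_Γ(τ)`. -/
def genFun (τ : E → E → ℂ) : ℂ :=
  ∫ z, Γ.integrand τ z ∂(Measure.pi fun _ : E => spinorMeasure)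

open Classical in
/-- The homogeneous antisymmetric weights: `τ_{ee'} = c` if `e < e'` and `τ_{ee'} = -c` if
`e > e'` at the common vertex of `e` and `e'`. -/
def homWeight (c : ℂ) (e e' : E) : ℂ :=
  if ∃ v, Γ.LtAt v e e' then c else if ∃ v, Γ.LtAt v e' e then -c else 0

/-! ### Even subgraphs and the Ising model -/

open Classical in
/-- `g_P`: the number of sets of `P` edges which meet every vertex an even number of times. -/
def evenCount (P : ℕ) : ℕ :=
  #{S : Finset E | #S = P ∧ ∀ v : V, Even #{e ∈ S | Γ.Inc e v}}

/-- The polynomial `1 + ∑_{P ≥ 1} g_P v^P`; the term `1` is the empty subgraph. -/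
def evenSum (v : ℂ) : ℂ := 1 + ∑ P ∈ Icc 1 (Fintype.card E), (Γ.evenCount P : ℂ) * v ^ P

open Classical in
/-- The Ising partition function at zero field, with one spin `±1` per vertex, nearest neighbour
interaction along the edges, and `K = βJ`. -/
def isingZ (K : ℝ) : ℝ :=
  ∑ σ : V → ℤˣ, Real.exp (K * ∑ e : E, ((σ (Γ.src e) : ℤ) : ℝ) * ((σ (Γ.tgt e) : ℤ) : ℝ))

end OrderedDigraph

end

/-! ### The square lattice -/

/-- Sites of the `m × n` square lattice. -/
abbrev Site (m n : ℕ) : Type := Fin m × Fin n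

/-- The four lattice directions in counterclockwise order: east, north, west, south. -/
def unitStep : Fin 4 → ℤ × ℤ := ![(1, 0), (0, 1), (-1, 0), (0, -1)]

/-- `q` is the nearest neighbour of `p` in direction `d`. -/
def IsStep {m n : ℕ} (p : Site m n) (d : Fin 4) (q : Site m n) : Prop :=
  ((q.1 : ℕ) : ℤ) = ((p.1 : ℕ) : ℤ) + (unitStep d).1 ∧
    ((q.2 : ℕ) : ℤ) = ((p.2 : ℕ) : ℤ) + (unitStep d).2

instance {m n : ℕ} (p : Site m n) (d : Fin 4) (q : Site m n) : Decidable (IsStep p d q) :=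
  inferInstanceAs (Decidable (_ ∧ _))

/-- Edges `(p, d, q)` of the lattice with the alternating orientation: each edge leaves a site `p`
of the checkerboard colour `c`, in direction `d`, and ends at the neighbour `q`, which is of the
other colour.  Each nearest neighbour pair occurs exactly once. -/
abbrev LatticeEdge (m n : ℕ) (c : Fin 2) : Type :=
  {e : Site m n × Fin 4 × Site m n //
    ((e.1.1 : ℕ) + (e.1.2 : ℕ)) % 2 = (c : ℕ) ∧ IsStep e.1 e.2.1 e.2.2}

/-- Position of the direction `d` when the four directions are listed starting with the reference
direction `r`, clockwise if `cw = true` and counterclockwise if `cw = false`. -/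
def cyclicRank (cw : Bool) (r d : Fin 4) : ℕ := if cw then (r - d).val else (d - r).val

/-- The `m × n` square lattice (free boundary) with alternating edge orientation.  The sites of
colour `c` are sources, the others are sinks.  At each source the edges are ordered starting from
the reference direction `r`, clockwise if `cw = true` and counterclockwise otherwise; at each sink
they are ordered in the opposite sense, starting from the reference direction `s`. The direction of
an edge at its target is the opposite of its direction at its source. -/
def squareLattice (m n : ℕ) (c : Fin 2) (cw : Bool) (r s : Fin 4) :
    OrderedDigraph (Site m n) (LatticeEdge m n c) where
  src e := e.1.1
  tgt e := e.1.2.2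
  rank v e := if e.1.1 = v then cyclicRank cw r e.1.2.1 else cyclicRank (!cw) s (e.1.2.1 + 2)
  src_ne_tgt := by
    rintro ⟨⟨p, d, q⟩, hc, h1, h2⟩ (rfl : p = q)
    fin_cases d <;> simp [unitStep] at h1 h2
  simple := by
    rintro ⟨⟨p, d, q⟩, hc, h⟩ ⟨⟨p', d', q'⟩, hc', h'⟩ (⟨rfl, rfl⟩ | ⟨rfl, rfl⟩)
    · simp only [IsStep] at h h'
      obtain rfl : d = d' := by
        fin_cases d <;> fin_cases d' <;> simp [unitStep] at h h' ⊢ <;> omega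
      rfl
    · exfalso
      simp only [IsStep] at hc hc' h h'
      fin_cases d <;> simp [unitStep] at h <;> omega
  rank_inj := by
    rintro v ⟨⟨p, d, q⟩, hc, h⟩ ⟨⟨p', d', q'⟩, hc', h'⟩ hv hv' hr
    simp only [IsStep] at hc hc' h h' hv hv' hr
    have key : ∀ (cw : Bool) (r d d' : Fin 4), cyclicRank cw r d = cyclicRank cw r d' → d = d' := by
      decide
    have par : (p.1 : ℕ) + p.2 + (q.1 + q.2) = 2 * (p.1 + p.2) + 1 ∨
        (p.1 : ℕ) + p.2 + (q.1 + q.2) + 1 = 2 * (p.1 + p.2) := by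
      fin_cases d <;> simp [unitStep] at h <;> omega
    have par' : (p'.1 : ℕ) + p'.2 + (q'.1 + q'.2) = 2 * (p'.1 + p'.2) + 1 ∨
        (p'.1 : ℕ) + p'.2 + (q'.1 + q'.2) + 1 = 2 * (p'.1 + p'.2) := by
      fin_cases d' <;> simp [unitStep] at h' <;> omega
    by_cases hp : p = v
    · subst hp
      obtain rfl : p' = p := by
        rcases hv' with rfl | rfl
        · rfl
        · omega
      simp only [if_true] at hr
      obtain rfl := key _ _ _ _ hr
      obtain rfl : q = q' := by
        ext <;> omega
      rfl
    · obtain rfl : q = v := by tauto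
      have hp' : p' ≠ q := by
        rintro rfl
        omega
      obtain rfl : q' = q := by tauto
      rw [if_neg hp, if_neg hp'] at hr
      obtain rfl : d = d' := add_right_cancel (key _ _ _ _ hr)
      obtain rfl : p = p' := by
        ext <;> omega
      rfl

/-! The proof equates a bosonic Gaussian integral with the inverse of a determinant, and that
determinant with the square of a fermionic overlap.

Bosonic side. With alternating orientations every bracket at a source is holomorphic in the spinors
and every bracket at a sink is antiholomorphic. In the variables `(α, β̄)` the exponent is a
sesquilinear form, so the integral is `det (1 - v² T S)⁻¹`, where `S` and `T` are the antisymmetric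
sign matrices of the orderings at sources and sinks (`Alternating.genFun_eq`). Absolute convergence
alone forces the determinant to be nonzero (`gaussian_integral_fin`).

Fermionic side. Let `ψ` be the superposition, with weight `v` per edge, of the edge sets that are
even at every source, and `φ` the analogous state for the sinks with weight `1`. Both are Gaussian:
annihilating an edge equals a combination, given by `S` or `T`, of creating edges
(`ann_blockState`). Their overlap `F(v)` sums `± v^#S` over the even subgraphs. The Wick relation
expresses the two-point function through `F` and `T S`, and its trace is `v F'(v)`; Jacobi's formula
then gives `F D' = 2 F' D` for `D = det (1 - v² T S)`, hence `D = F²` (`det_eq_sq_of_relation`,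
`det_blockSign_eq_sq`).

Signs. The sign of an even subgraph in `F` is that of the permutation from the order by sources to
the order by sinks. Its exponent is a quadratic form modulo two on the cycle space, which is spanned
by elementary squares. Opposite rotational senses make each square orthogonal to all cycles under
the polar form, and perpendicular reference directions make the form vanish on each square; so every
sign is `+1` (`IsCycle.invForm_eq_zero`).

The convergence disc comes from the operator norm `1 + √2 = (√2 - 1)⁻¹` of the `4 × 4` sign matrix,
and the Ising form from the high temperature expansion (`isingZ_eq`). -/

/-! ### Fermionic Fock space -/

section Fock

variable {ι L : Type} [LinearOrder L]

/-- The Jordan–Wigner sign of `i` relative to `T`. -/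
def jwSign (κ : ι → L) (i : ι) (T : Finset ι) : ℂ := (-1) ^ #{j ∈ T | κ j < κ i}

theorem jwSign_mul_self (κ : ι → L) (i : ι) (T : Finset ι) :
    jwSign κ i T * jwSign κ i T = 1 := by
  unfold jwSign
  rw [← mul_pow]; simp

variable [DecidableEq ι]

theorem jwSign_insert (κ : ι → L) (i : ι) {k : ι} {T : Finset ι} (hk : k ∉ T) :
    jwSign κ i (insert k T) = jwSign κ i T * (if κ k < κ i then -1 else 1) := by
  unfold jwSign
  rw [filter_insert]
  split_ifs with h
  · rw [card_insert_of_notMem (by simp [hk]), pow_succ]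
  · simp

theorem jwSign_erase (κ : ι → L) (i : ι) {k : ι} {T : Finset ι} (hk : k ∈ T) :
    jwSign κ i (T.erase k) = jwSign κ i T * (if κ k < κ i then -1 else 1) := by
  conv_rhs => rw [← insert_erase hk, jwSign_insert κ i (notMem_erase k T)]
  split_ifs <;> simp

theorem jwSign_erase_self (κ : ι → L) (i : ι) (T : Finset ι) :
    jwSign κ i (T.erase i) = jwSign κ i T := by
  by_cases h : i ∈ T
  · simp [jwSign_erase κ i h]
  · rw [erase_eq_of_notMem h]

theorem jwSign_insert_self (κ : ι → L) (i : ι) (T : Finset ι) :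
    jwSign κ i (insert i T) = jwSign κ i T := by
  rw [← jwSign_erase_self, erase_insert_eq_erase, jwSign_erase_self]

/-- The annihilation operator. -/
def ann (κ : ι → L) (i : ι) : (Finset ι → ℂ) →ₗ[ℂ] (Finset ι → ℂ) where
  toFun ψ T := if i ∈ T then 0 else jwSign κ i T * ψ (insert i T)
  map_add' ψ φ := by
    ext T; simp only [Pi.add_apply]; split_ifs <;> ring
  map_smul' c ψ := by
    ext T; simp only [Pi.smul_apply, smul_eq_mul, RingHom.id_apply]; split_ifs <;> ring

/-- The creation operator. -/
def cre (κ : ι → L) (i : ι) : (Finset ι → ℂ) →ₗ[ℂ] (Finset ι → ℂ) where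
  toFun ψ T := if i ∈ T then jwSign κ i T * ψ (T.erase i) else 0
  map_add' ψ φ := by
    ext T; simp only [Pi.add_apply]; split_ifs <;> ring
  map_smul' c ψ := by
    ext T; simp only [Pi.smul_apply, smul_eq_mul, RingHom.id_apply]; split_ifs <;> ring

theorem ann_apply (κ : ι → L) (i : ι) (ψ : Finset ι → ℂ) (T : Finset ι) :
    ann κ i ψ T = if i ∈ T then 0 else jwSign κ i T * ψ (insert i T) := rfl

theorem cre_apply (κ : ι → L) (i : ι) (ψ : Finset ι → ℂ) (T : Finset ι) :
    cre κ i ψ T = if i ∈ T then jwSign κ i T * ψ (T.erase i) else 0 := rfl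

theorem cre_ann_self_apply (κ : ι → L) (i : ι) (ψ : Finset ι → ℂ) (T : Finset ι) :
    cre κ i (ann κ i ψ) T = if i ∈ T then ψ T else 0 := by
  rw [cre_apply, ann_apply]
  split_ifs with h h'
  · simp at h'
  · rw [jwSign_erase_self, ← mul_assoc, jwSign_mul_self, insert_erase h, one_mul]
  · rfl

theorem ann_cre_self (κ : ι → L) (i : ι) (ψ : Finset ι → ℂ) :
    ann κ i (cre κ i ψ) = ψ - cre κ i (ann κ i ψ) := by
  ext T
  rw [Pi.sub_apply, cre_ann_self_apply, ann_apply, cre_apply]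
  split_ifs with h h'
  · simp
  · rw [jwSign_insert_self, ← mul_assoc, jwSign_mul_self, erase_insert h, one_mul, sub_zero]
  · simp at h'

/-- Canonical anticommutation: the operators applied in the two orders see Jordan–Wigner signs that
differ by one factor, because exactly one of `κ i < κ j` and `κ j < κ i` holds. -/
theorem ann_cre_of_ne {κ : ι → L} (hκ : Function.Injective κ) {i j : ι} (hij : i ≠ j)
    (ψ : Finset ι → ℂ) : ann κ i (cre κ j ψ) = -cre κ j (ann κ i ψ) := by
  ext T
  have hs : (if κ i < κ j then (-1 : ℂ) else 1) = -(if κ j < κ i then -1 else 1) := by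
    rcases lt_or_gt_of_ne (hκ.ne hij) with h | h <;> simp [h, h.not_gt]
  rw [Pi.neg_apply, ann_apply, cre_apply, cre_apply, ann_apply]
  by_cases hi : i ∈ T <;> by_cases hj : j ∈ T <;> simp [hi, hj, hij, hij.symm]
  rw [jwSign_insert κ j hi, jwSign_erase κ i hj, hs, erase_insert_of_ne hij]
  ring

theorem ann_ann {κ : ι → L} (hκ : Function.Injective κ) (i j : ι)
    (ψ : Finset ι → ℂ) : ann κ i (ann κ j ψ) = -ann κ j (ann κ i ψ) := by
  ext T
  rw [Pi.neg_apply]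
  simp only [ann_apply]
  by_cases hij : i = j
  · subst hij; simp
  have hs : (if κ i < κ j then (-1 : ℂ) else 1) = -(if κ j < κ i then -1 else 1) := by
    rcases lt_or_gt_of_ne (hκ.ne hij) with h | h <;> simp [h, h.not_gt]
  have hji : ¬ j = i := fun h => hij h.symm
  by_cases hi : i ∈ T <;> by_cases hj : j ∈ T <;> simp [hi, hj, hij, hji]
  rw [jwSign_insert κ j hi, jwSign_insert κ i hj, hs, Finset.insert_comm]
  ring

/-- The pairing is bilinear, without conjugation, so creation and annihilation are transposes of
each other. This keeps every overlap polynomial in the weights. -/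
theorem ann_dotProduct [Fintype ι] (κ : ι → L) (i : ι) (φ ψ : Finset ι → ℂ) :
    ann κ i φ ⬝ᵥ ψ = φ ⬝ᵥ cre κ i ψ := by
  simp only [dotProduct, ann_apply, cre_apply, ite_mul, zero_mul, mul_ite, mul_zero]
  have h0 : ∀ (T : Finset ι) (x : ℂ), (if i ∈ T then 0 else x) = if i ∉ T then x else 0 := by
    intro T x; split_ifs <;> rfl
  simp only [h0]
  rw [← sum_filter, ← sum_filter]
  refine sum_bij' (fun T _ => insert i T) (fun T _ => T.erase i) ?_ ?_ ?_ ?_ ?_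
  · simp
  · simp
  · intro T hT
    simp only [mem_filter, mem_univ, true_and] at hT
    exact erase_insert hT
  · intro T hT
    simp only [mem_filter, mem_univ, true_and] at hT
    exact insert_erase hT
  · intro T hT
    simp only [mem_filter, mem_univ, true_and] at hT
    rw [jwSign_insert_self, erase_insert hT]
    ring

theorem cre_dotProduct [Fintype ι] (κ : ι → L) (i : ι) (φ ψ : Finset ι → ℂ) :
    cre κ i φ ⬝ᵥ ψ = φ ⬝ᵥ ann κ i ψ := by
  rw [dotProduct_comm, ← ann_dotProduct, dotProduct_comm]

/-- The two-point function `⟨φ, c_i† c_j ψ⟩`. -/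
def twoPoint [Fintype ι] (κ : ι → L) (φ ψ : Finset ι → ℂ) : Matrix ι ι ℂ :=
  Matrix.of fun i j => φ ⬝ᵥ cre κ i (ann κ j ψ)

/-- The trace is the expectation of the number operator, which acts on weights `v ^ #T` as the Euler
operator `v d/dv`. -/
theorem trace_twoPoint [Fintype ι] (κ : ι → L) (φ ψ : Finset ι → ℂ) :
    (twoPoint κ φ ψ).trace = ∑ T, (#T : ℂ) * (φ T * ψ T) := by
  simp only [Matrix.trace, Matrix.diag, twoPoint, Matrix.of_apply, dotProduct, cre_ann_self_apply]
  rw [sum_comm]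
  refine sum_congr rfl fun T _ => ?_
  simp only [mul_ite, mul_zero]
  rw [← sum_filter]
  simp

/-- The Wick relation for a pair of Gaussian fermionic states. -/
theorem twoPoint_relation [Fintype ι] {κ : ι → L} (hκ : Function.Injective κ)
    {φ ψ : Finset ι → ℂ} {A B : Matrix ι ι ℂ}
    (hψ : ∀ i, ann κ i ψ = ∑ j, A i j • cre κ j ψ)
    (hφ : ∀ i, ann κ i φ = ∑ j, B i j • cre κ j φ) :
    twoPoint κ φ ψ = -(B * A * ((φ ⬝ᵥ ψ) • 1 - twoPoint κ φ ψ)) := by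
  have hC : ∀ i j, twoPoint κ φ ψ i j = ∑ l, B i l * (φ ⬝ᵥ ann κ l (ann κ j ψ)) := by
    intro i j
    simp only [twoPoint, Matrix.of_apply]
    rw [← ann_dotProduct, hφ, sum_dotProduct]
    simp only [smul_dotProduct, cre_dotProduct, smul_eq_mul]
  -- Anticommute the two annihilators, turn the one now acting on `ψ` into creators, and reorder:
  -- the pair `c_j c_k†` contributes the identity minus the two-point function.
  have hD : ∀ l j, φ ⬝ᵥ ann κ l (ann κ j ψ) =
      -∑ k, A l k * ((φ ⬝ᵥ ψ) • (1 : Matrix ι ι ℂ) - twoPoint κ φ ψ) k j := by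
    intro l j
    rw [ann_ann hκ, dotProduct_neg, hψ, map_sum, dotProduct_sum]
    congr 1
    refine sum_congr rfl fun k _ => ?_
    rw [map_smul, dotProduct_smul, smul_eq_mul, Matrix.sub_apply, Matrix.smul_apply,
      Matrix.one_apply]
    congr 1
    simp only [twoPoint, Matrix.of_apply]
    by_cases hkj : k = j
    · subst hkj
      simp [ann_cre_self, dotProduct_sub]
    · simp [ann_cre_of_ne hκ (Ne.symm hkj), hkj]
  ext i j
  rw [hC, Matrix.neg_apply, Matrix.mul_assoc, Matrix.mul_apply, ← sum_neg_distrib]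
  refine sum_congr rfl fun l _ => ?_
  rw [hD, Matrix.mul_apply, mul_neg]

end Fock

/-! ### Gaussian states of block-even sets, and change of ordering. -/

section BlockStates

variable {ι L V : Type} [LinearOrder L] [DecidableEq V]

/-- `1` above the diagonal and `-1` below, inside each block; `0` between different blocks. -/
def blockSign (κ : ι → L) (b : ι → V) (i j : ι) : ℂ :=
  if b i = b j then (if κ i < κ j then 1 else if κ j < κ i then -1 else 0) else 0

/-- The superposition of the sets which meet every block an even number of times. -/
noncomputable def blockState (b : ι → V) (x : ℂ) : Finset ι → ℂ :=
  open Classical in fun S => if ∀ v, Even #{e ∈ S | b e = v} then x ^ #S else 0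

theorem blockState_of_even {b : ι → V} {x : ℂ} {S : Finset ι}
    (h : ∀ v, Even #{e ∈ S | b e = v}) : blockState b x S = x ^ #S := if_pos h

theorem blockState_of_not_even {b : ι → V} {x : ℂ} {S : Finset ι}
    (h : ¬ ∀ v, Even #{e ∈ S | b e = v}) : blockState b x S = 0 := if_neg h

variable [DecidableEq ι]

/-- Along increasing `κ` the signs are `1, -1, 1, …`, so the sum is `0` or `1` according to the
parity of `#W`. -/
theorem sum_alternating {κ : ι → L} (hκ : Function.Injective κ) (W : Finset ι) :
    2 * ∑ j ∈ W, jwSign κ j W = 1 - (-1) ^ #W := by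
  induction W using Finset.induction_on_max_value κ with
  | empty => simp
  | insert a s ha hmax ih =>
    rw [sum_insert ha, card_insert_of_notMem ha, mul_add, jwSign_insert_self]
    have h1 : ∑ j ∈ s, jwSign κ j (insert a s) = ∑ j ∈ s, jwSign κ j s := by
      refine sum_congr rfl fun j hj => ?_
      rw [jwSign_insert κ j ha, if_neg (hmax j hj).not_gt, mul_one]
    have h2 : jwSign κ a s = (-1) ^ #s := by
      unfold jwSign
      rw [filter_true_of_mem]
      exact fun j hj => lt_of_le_of_ne (hmax j hj) fun h => ha (hκ h ▸ hj)
    rw [h1, ih, h2]; ring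

/-- Alternating sum identity in a set of odd cardinality. -/
theorem sum_sign_alternating {κ : ι → L} (hκ : Function.Injective κ) {U : Finset ι}
    (hU : Odd #U) (i : ι) :
    ∑ j ∈ U, (if κ i < κ j then (1 : ℂ) else if κ j < κ i then -1 else 0) * jwSign κ j U =
      if i ∈ U then 0 else jwSign κ i U := by
  have htot := sum_alternating hκ U
  have hlow := sum_alternating hκ {j ∈ U | κ j < κ i}
  have h1 : ∑ j ∈ U with κ j < κ i, jwSign κ j {j ∈ U | κ j < κ i} =
      ∑ j ∈ U, if κ j < κ i then jwSign κ j U else 0 := by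
    rw [← sum_filter]
    refine sum_congr rfl fun j hj => ?_
    unfold jwSign
    rw [filter_filter]
    congr 2
    ext k
    simp only [mem_filter] at hj ⊢
    exact ⟨fun h => ⟨h.1, h.2.2⟩, fun h => ⟨h.1, h.2.trans hj.2, h.2⟩⟩
  rw [h1, show (-1 : ℂ) ^ #{j ∈ U | κ j < κ i} = jwSign κ i U from rfl] at hlow
  rw [hU.neg_one_pow] at htot
  -- The coefficient is `1 - 2·[κ j < κ i] - [j = i]`, which reduces the sum to the full alternating
  -- sum and the one over the elements below `i`.
  have h2 : ∑ j ∈ U, (if κ i < κ j then (1 : ℂ) else if κ j < κ i then -1 else 0) * jwSign κ j U =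
      ∑ j ∈ U, jwSign κ j U - 2 * (∑ j ∈ U, if κ j < κ i then jwSign κ j U else 0) -
        ∑ j ∈ U, if j = i then jwSign κ j U else 0 := by
    rw [mul_sum, ← sum_sub_distrib, ← sum_sub_distrib]
    refine sum_congr rfl fun j _ => ?_
    rcases lt_trichotomy (κ j) (κ i) with h | h | h
    · have : j ≠ i := fun hh => h.ne (hh ▸ rfl)
      simp [h, h.not_gt, this]; ring
    · have : j = i := hκ h
      simp [this]
    · have : j ≠ i := fun hh => h.ne' (hh ▸ rfl)
      simp [h, h.not_gt, this]
  rw [h2, hlow, sum_ite_eq']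
  split_ifs <;> linear_combination htot / 2

/-- Together with `even_erase_iff`: adding `i`, or removing any `j` of the same block, repairs
parity under the same condition, namely that the block of `i` is the only odd one. Hence both sides
of `ann_blockState` have the same support. -/
theorem even_insert_iff (b : ι → V) {i : ι} {T : Finset ι} (hi : i ∉ T) :
    (∀ v, Even #{e ∈ insert i T | b e = v}) ↔
      ∀ v, (Even #{e ∈ T | b e = v} ↔ v ≠ b i) := by
  refine forall_congr' fun v => ?_
  rw [filter_insert]
  by_cases h : b i = v
  · rw [if_pos h, card_insert_of_notMem (by simp [hi]), Nat.even_add_one]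
    simp [h]
  · rw [if_neg h]
    simp [Ne.symm h]

theorem even_erase_iff (b : ι → V) {j : ι} {T : Finset ι} (hj : j ∈ T) :
    (∀ v, Even #{e ∈ T.erase j | b e = v}) ↔
      ∀ v, (Even #{e ∈ T | b e = v} ↔ v ≠ b j) := by
  have := even_insert_iff b (notMem_erase j T)
  rw [insert_erase hj] at this
  refine forall_congr' fun v => ?_
  rw [filter_erase]
  by_cases h : b j = v
  · have hm : j ∈ {e ∈ T | b e = v} := by simp [hj, h]
    have hc := card_erase_add_one hm
    rw [← hc, Nat.even_add_one]
    simp [h]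
  · rw [erase_eq_of_notMem (by simp [h])]
    simp [Ne.symm h]

/-- By `hconv` each block is an interval of the order, so the elements of other blocks contribute a
common sign, and the alternating sum identity applies inside the odd block. The factor `x ^ 2`
appears because inserting `i` and erasing `j` yield cardinalities that differ by two. -/
theorem ann_blockState [Fintype ι] {κ : ι → L} (hκ : Function.Injective κ) (b : ι → V)
    (hconv : ∀ i j k, b i = b j → b k ≠ b i → (κ k < κ i ↔ κ k < κ j)) (x : ℂ) (i : ι) :
    ann κ i (blockState b x) =
      ∑ j, ((x ^ 2) • Matrix.of (blockSign κ b)) i j • cre κ j (blockState b x) := by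
  classical
  ext T
  rw [Finset.sum_apply]
  simp only [Pi.smul_apply, smul_eq_mul, Matrix.smul_apply, Matrix.of_apply, cre_apply]
  by_cases hT : ∀ v, (Even #{e ∈ T | b e = v} ↔ v ≠ b i)
  swap
  · rw [ann_apply, sum_eq_zero]
    · split_ifs with hi
      · rfl
      · rw [blockState_of_not_even, mul_zero]
        rwa [even_insert_iff b hi]
    · intro j _
      by_cases hb : b i = b j
      · split_ifs with hj
        · rw [blockState_of_not_even, mul_zero, mul_zero]
          rwa [even_erase_iff b hj, ← hb]
        · simp
      · simp [blockSign, hb]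
  set U := {e ∈ T | b e = b i} with hUdef
  have hU : Odd #U := by
    rw [← Nat.not_even_iff_odd, hT (b i)]
    simp
  set c : ℂ := (-1) ^ #{k ∈ T | b k ≠ b i ∧ κ k < κ i} with hc
  have hsign : ∀ j, b i = b j → jwSign κ j T = c * jwSign κ j U := by
    intro j hj
    rw [hc, jwSign, jwSign, ← pow_add]
    congr 1
    rw [hUdef, filter_filter, ← card_union_of_disjoint]
    · congr 1
      ext k
      simp only [mem_filter, mem_union]
      by_cases hk : b k = b i
      · simp [hk]
      · simp [hk, hconv i j k hj hk]
    · rw [disjoint_filter]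
      tauto
  have hsum : ∀ j, (x ^ 2 * blockSign κ b i j *
      if j ∈ T then jwSign κ j T * blockState b x (T.erase j) else 0) =
      if j ∈ U then (c * x ^ (#T + 1)) *
        ((if κ i < κ j then (1 : ℂ) else if κ j < κ i then -1 else 0) * jwSign κ j U) else 0 := by
    intro j
    by_cases hb : b i = b j
    · by_cases hj : j ∈ T
      · have hjU : j ∈ U := by simp [hUdef, hj, hb]
        rw [if_pos hj, if_pos hjU, hsign j hb, blockSign, if_pos hb, blockState_of_even]
        · rw [show #T = #(T.erase j) + 1 from (card_erase_add_one hj).symm]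
          ring
        · rwa [even_erase_iff b hj, ← hb]
      · have hjU : j ∉ U := by simp [hUdef, hj]
        simp [hj, hjU]
    · have hjU : j ∉ U := by simp [hUdef, Ne.symm hb]
      simp [hjU, blockSign, hb]
  simp only [hsum]
  rw [← sum_filter, filter_mem_eq_inter, univ_inter, ← mul_sum, sum_sign_alternating hκ hU,
    ann_apply]
  by_cases hi : i ∈ T
  · have : i ∈ U := by simp [hUdef, hi]
    simp [hi, this]
  · have : i ∉ U := by simp [hUdef, hi]
    rw [if_neg hi, if_neg this, hsign i rfl, blockState_of_even, card_insert_of_notMem hi]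
    · ring
    · rwa [even_insert_iff b hi]

/-- The sign of the permutation of `S` from the order `κ` to the order `κ'`. -/
def inversionSign {L' : Type} [LinearOrder L'] (κ : ι → L) (κ' : ι → L') (S : Finset ι) : ℂ :=
  ∏ e ∈ S, ∏ f ∈ S, if κ e < κ f ∧ κ' f < κ' e then -1 else 1

theorem inversionSign_insert {L' : Type} [LinearOrder L'] {κ : ι → L} {κ' : ι → L'}
    (hκ : Function.Injective κ) (hκ' : Function.Injective κ') {i : ι} {T : Finset ι}
    (hi : i ∉ T) :
    jwSign κ i T * inversionSign κ κ' (insert i T) = inversionSign κ κ' T * jwSign κ' i T := by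
  have hj : ∀ {M : Type} [LinearOrder M] (μ : ι → M),
      jwSign μ i T = ∏ f ∈ T, if μ f < μ i then (-1 : ℂ) else 1 := by
    intro M _ μ
    rw [jwSign, prod_ite, prod_const, prod_const_one, mul_one]
  have hT : inversionSign κ κ' (insert i T) =
      (∏ f ∈ T, (if κ i < κ f ∧ κ' f < κ' i then (-1 : ℂ) else 1) *
        (if κ f < κ i ∧ κ' i < κ' f then -1 else 1)) * inversionSign κ κ' T := by
    unfold inversionSign
    rw [prod_insert hi, prod_insert hi, prod_mul_distrib]
    simp only [prod_insert hi, prod_mul_distrib, lt_irrefl, false_and, if_false, one_mul]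
    ring
  rw [hT, hj κ, hj κ', ← mul_assoc, ← prod_mul_distrib, mul_comm]
  congr 1
  refine prod_congr rfl fun f hf => ?_
  have hne : f ≠ i := fun h => hi (h ▸ hf)
  rcases lt_or_gt_of_ne (hκ.ne hne) with h | h <;>
    rcases lt_or_gt_of_ne (hκ'.ne hne) with h' | h' <;>
    simp [h, h', h.not_gt, h'.not_gt]

/-- Multiplication by the inversion sign intertwines the Jordan–Wigner representations of the two
orders. The sink state, Gaussian for `κ'`, thus becomes Gaussian for `κ`, with the same matrix. -/
theorem ann_inversionSign_mul {L' : Type} [LinearOrder L'] {κ : ι → L} {κ' : ι → L'}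
    (hκ : Function.Injective κ) (hκ' : Function.Injective κ') (i : ι) (ψ : Finset ι → ℂ) :
    ann κ i (inversionSign κ κ' * ψ) = inversionSign κ κ' * ann κ' i ψ := by
  ext T
  rw [ann_apply, Pi.mul_apply, Pi.mul_apply, ann_apply]
  split_ifs with h
  · simp
  · rw [← mul_assoc, inversionSign_insert hκ hκ' h, mul_assoc]

theorem cre_inversionSign_mul {L' : Type} [LinearOrder L'] {κ : ι → L} {κ' : ι → L'}
    (hκ : Function.Injective κ) (hκ' : Function.Injective κ') (i : ι) (ψ : Finset ι → ℂ) :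
    cre κ i (inversionSign κ κ' * ψ) = inversionSign κ κ' * cre κ' i ψ := by
  ext T
  rw [cre_apply, Pi.mul_apply, Pi.mul_apply, cre_apply]
  split_ifs with h
  · have h1 := inversionSign_insert hκ hκ' (notMem_erase i T)
    rw [insert_erase h, jwSign_erase_self, jwSign_erase_self] at h1
    have h2 := jwSign_mul_self κ i T
    have h3 := jwSign_mul_self κ' i T
    have h4 : jwSign κ i T * inversionSign κ κ' (T.erase i) =
        inversionSign κ κ' T * jwSign κ' i T := by
      linear_combination (-jwSign κ i T * inversionSign κ κ' (T.erase i)) * h3 +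
        (inversionSign κ κ' T * jwSign κ' i T) * h2 - jwSign κ' i T * jwSign κ i T * h1
    rw [← mul_assoc, h4, mul_assoc]
  · simp

end BlockStates

/-! ### From the Wick relation to a determinant that is a perfect square. -/

section PfaffianSquare

open Polynomial in
-- Both `p` and `q ^ 2` solve the linear equation `q y' = 2 q' y` with value `1` at `0`. If the
-- difference had order `k + 1` at `0`, comparing the coefficients of `X ^ k` would make its leading
-- coefficient vanish, since `q 0 ≠ 0`.
theorem eq_sq_of_mul_derivative_eq {p q : ℂ[X]} (hp : p.eval 0 = 1) (hq : q.eval 0 = 1)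
    (h : q * derivative p = 2 * p * derivative q) : p = q ^ 2 := by
  by_contra hne
  obtain ⟨U, hU, hdvd⟩ := exists_eq_pow_rootMultiplicity_mul_and_not_dvd (p - q ^ 2)
    (sub_ne_zero.mpr hne) 0
  have hroot : (p - q ^ 2).IsRoot 0 := by simp [hp, hq]
  have hk := (rootMultiplicity_pos (sub_ne_zero.mpr hne)).mpr hroot
  obtain ⟨k, hk'⟩ := Nat.exists_eq_add_of_lt hk
  rw [hk', zero_add, C_0, sub_zero] at hU
  rw [C_0, sub_zero] at hdvd
  have hH : q * derivative (p - q ^ 2) = 2 * derivative q * (p - q ^ 2) := by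
    simp only [derivative_sub, derivative_pow]
    simp only [Nat.cast_ofNat, C_ofNat]
    linear_combination h
  rw [hU, derivative_mul, derivative_X_pow] at hH
  have h2 : X ^ k * (q * (((k + 1 : ℕ) : ℂ[X]) * U + X * derivative U)) =
      X ^ k * (2 * derivative q * X * U) := by
    simp only [Nat.add_sub_cancel, map_natCast] at hH
    linear_combination hH
  have h3 := congrArg (eval 0) (mul_left_cancel₀ (pow_ne_zero _ X_ne_zero) h2)
  simp [hq] at h3
  rcases h3 with h3 | h3
  · exact absurd h3 (by exact_mod_cast Nat.succ_ne_zero k)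
  · exact hdvd (X_dvd_iff.mpr (by rwa [coeff_zero_eq_eval_zero]))

variable {ι : Type} [Fintype ι] [DecidableEq ι]

theorem hasDerivAt_det_one_add_smul (Y : Matrix ι ι ℂ) :
    HasDerivAt (fun s : ℂ => (1 + s • Y).det) Y.trace 0 := by
  have h := (Matrix.det (1 + (Polynomial.X : Polynomial ℂ) • Y.map Polynomial.C)).hasDerivAt 0
  rw [Matrix.derivative_det_one_add_X_smul] at h
  refine h.congr_of_eventuallyEq (Filter.Eventually.of_forall fun s => ?_)
  change (1 + s • Y).det = Polynomial.eval s _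
  rw [← Polynomial.coe_evalRingHom, RingHom.map_det]
  congr 1
  ext i j
  simp [Matrix.one_apply, apply_ite (Polynomial.eval s), mul_comm s]

open Polynomial in
-- The relation says `(1 - v² Y)(q - C) = q`, so `C` gives the inverse of `1 - v² Y` wherever `q v ≠
-- 0`. Jacobi's formula and the trace of `C` then give the logarithmic derivative `2 q' / q` of the
-- determinant.
theorem det_eq_sq_of_relation (Y : Matrix ι ι ℂ) (q : ℂ[X]) (hq : q.eval 0 = 1)
    (h : ∀ v : ℂ, ∃ C : Matrix ι ι ℂ, C = -(v ^ 2 • Y * (q.eval v • 1 - C)) ∧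
      C.trace = v * q.derivative.eval v) (v : ℂ) :
    (1 - v ^ 2 • Y).det = q.eval v ^ 2 := by
  set p : ℂ[X] := Matrix.det (1 - (X ^ 2 : ℂ[X]) • Y.map C) with hpdef
  have hpe : ∀ v : ℂ, p.eval v = (1 - v ^ 2 • Y).det := by
    intro v
    rw [← coe_evalRingHom, hpdef, RingHom.map_det]
    congr 1
    ext i j
    simp [Matrix.one_apply, apply_ite (Polynomial.eval v), mul_comm (Y i j)]
  suffices hpq : p = q ^ 2 by rw [← hpe, hpq, eval_pow]
  have hq0 : q ≠ 0 := by rintro rfl; simp at hq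
  refine eq_sq_of_mul_derivative_eq (by simp [hpe]) hq ?_
  -- The trace carries a factor `v`, hence the extra `X`. The identity is checked off the finitely
  -- many roots of `q`, which suffices for polynomials.
  have key : X * (q * derivative p) = X * (2 * p * derivative q) := by
    refine eq_of_infinite_eval_eq _ _ ?_
    refine Set.Infinite.mono (s := (↑q.roots.toFinset : Set ℂ)ᶜ) ?_
      (Set.Finite.infinite_compl (Finset.finite_toSet _))
    intro v hv
    have hv' : q.eval v ≠ 0 := by
      intro h0
      exact hv (by simp [hq0, h0])
    obtain ⟨C, hC, htr⟩ := h v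
    set N := q.eval v • (1 : Matrix ι ι ℂ) - C with hN
    have hMN : (1 - v ^ 2 • Y) * N = q.eval v • 1 := by
      rw [sub_mul, one_mul]
      nth_rewrite 1 [hN]
      rw [eq_neg_iff_add_eq_zero] at hC
      linear_combination (norm := module) -hC
    set M := 1 - v ^ 2 • Y with hM
    have hinv : M * ((q.eval v)⁻¹ • N) = 1 := by
      rw [Matrix.mul_smul, hMN, smul_smul, inv_mul_cancel₀ hv', one_smul]
    set W := (q.eval v)⁻¹ • N with hW
    have hYW : v ^ 2 * (W * Y).trace = -(q.eval v)⁻¹ * (v * q.derivative.eval v) := by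
      rw [Matrix.trace_mul_comm, ← smul_eq_mul (v ^ 2), ← Matrix.trace_smul, ← Matrix.smul_mul,
        hW, Matrix.mul_smul, Matrix.trace_smul, ← htr]
      have : v ^ 2 • Y * N = -C := (neg_eq_iff_eq_neg.mpr hC).symm
      rw [this, Matrix.trace_neg, smul_eq_mul]; ring
    -- As `W` inverts `M = 1 - v² Y`, the function differentiated here is `t ↦ det (1 - t² Y)` with
    -- `det M` factored out.
    have hder : HasDerivAt (fun t : ℂ => M.det * (1 + (v ^ 2 - t ^ 2) • (W * Y)).det)
        (M.det * ((W * Y).trace * (-(2 * v)))) v := by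
      have h1 := hasDerivAt_det_one_add_smul (W * Y)
      have h2 : HasDerivAt (fun t : ℂ => v ^ 2 - t ^ 2) (-(2 * v)) v := by
        have := (hasDerivAt_pow 2 v).const_sub (v ^ 2)
        simpa using this
      have h3 : HasDerivAt (fun s : ℂ => (1 + s • (W * Y)).det) (W * Y).trace (v ^ 2 - v ^ 2) := by
        rwa [sub_self]
      exact (h3.comp v h2).const_mul _
    have hfun : (fun t : ℂ => M.det * (1 + (v ^ 2 - t ^ 2) • (W * Y)).det) =
        fun t => p.eval t := by
      ext t
      rw [hpe, ← Matrix.det_mul]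
      congr 1
      rw [mul_add, mul_one, Matrix.mul_smul, ← mul_assoc, hinv, one_mul, hM]
      module
    rw [hfun] at hder
    have hd := (p.hasDerivAt v).unique hder
    simp only [Set.mem_ofPred_eq, eval_mul, eval_X, eval_ofNat]
    rw [hd, hpe v, ← hM]
    field_simp at hYW
    linear_combination (-2 * M.det) * hYW
  exact mul_left_cancel₀ X_ne_zero key

end PfaffianSquare

/-! ### The determinant as the square of the even subgraph sum. -/

section EvenSum

variable {ι L L' V V' : Type} [Fintype ι] [DecidableEq ι] [LinearOrder L] [LinearOrder L']
  [DecidableEq V] [DecidableEq V']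

open Classical in
/-- The determinant of the product of two block sign matrices is the square of a generating
function of sets which are even for both block structures. -/
theorem det_blockSign_eq_sq {κ : ι → L} {κ' : ι → L'} (hκ : Function.Injective κ)
    (hκ' : Function.Injective κ') (b : ι → V) (b' : ι → V')
    (hconv : ∀ i j k, b i = b j → b k ≠ b i → (κ k < κ i ↔ κ k < κ j))
    (hconv' : ∀ i j k, b' i = b' j → b' k ≠ b' i → (κ' k < κ' i ↔ κ' k < κ' j))
    (hsgn : ∀ S : Finset ι, (∀ v, Even #{e ∈ S | b e = v}) → (∀ v, Even #{e ∈ S | b' e = v}) →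
      inversionSign κ κ' S = 1) (v : ℂ) :
    (1 - v ^ 2 • (Matrix.of (blockSign κ' b') * Matrix.of (blockSign κ b))).det =
      (∑ S : Finset ι with (∀ v, Even #{e ∈ S | b e = v}) ∧ (∀ v, Even #{e ∈ S | b' e = v}),
        v ^ #S) ^ 2 := by
  set 𝒮 : Finset (Finset ι) :=
    {S | (∀ v, Even #{e ∈ S | b e = v}) ∧ (∀ v, Even #{e ∈ S | b' e = v})} with h𝒮
  set q : Polynomial ℂ := ∑ S ∈ 𝒮, Polynomial.X ^ #S with hq
  have hqe : ∀ v, q.eval v = ∑ S ∈ 𝒮, v ^ #S := by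
    intro v; rw [hq, Polynomial.eval_finsetSum]; simp
  rw [← hqe]
  have hprod : ∀ (v : ℂ) T, (inversionSign κ κ' * blockState b' 1) T * blockState b v T =
      if T ∈ 𝒮 then v ^ #T else 0 := by
    intro v T
    rw [Pi.mul_apply]
    by_cases h1 : ∀ v, Even #{e ∈ T | b e = v}
    · by_cases h2 : ∀ v, Even #{e ∈ T | b' e = v}
      · rw [blockState_of_even h1, blockState_of_even h2, if_pos (by simp [h𝒮, h1, h2]),
          hsgn T h1 h2]
        simp
      · rw [blockState_of_not_even h2, if_neg (by simp only [h𝒮, mem_filter]; tauto)]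
        simp
    · rw [blockState_of_not_even h1, if_neg (by simp only [h𝒮, mem_filter]; tauto)]
      simp
  -- All of the weight `v` sits in `ψ`, while `φ` has weight `1`. The overlap is then `q v`, and the
  -- relation involves `v²` times a fixed matrix.
  refine det_eq_sq_of_relation _ q ?_ (fun v => ⟨twoPoint κ (inversionSign κ κ' * blockState b' 1)
    (blockState b v), ?_, ?_⟩) v
  · rw [hqe, sum_eq_single ∅]
    · simp
    · intro S _ hS
      exact zero_pow (by simpa using hS)
    · simp [h𝒮]
  · have hF : (inversionSign κ κ' * blockState b' 1) ⬝ᵥ blockState b v = q.eval v := by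
      simp only [dotProduct, hprod, hqe]
      rw [← sum_filter, filter_mem_eq_inter, univ_inter]
    have := twoPoint_relation hκ (φ := inversionSign κ κ' * blockState b' 1)
      (ψ := blockState b v) (A := (v ^ 2) • Matrix.of (blockSign κ b))
      (B := Matrix.of (blockSign κ' b'))
      (fun i => ann_blockState hκ b hconv v i) ?_
    · rw [hF, Matrix.mul_smul] at this
      exact this
    · intro i
      rw [ann_inversionSign_mul hκ hκ', ann_blockState hκ' b' hconv', mul_sum]
      refine sum_congr rfl fun j _ => ?_
      rw [cre_inversionSign_mul hκ hκ', one_pow, one_smul, mul_smul_comm]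
  · rw [trace_twoPoint]
    simp only [hprod]
    rw [hq, Polynomial.derivative_sum, Polynomial.eval_finsetSum, mul_sum]
    simp only [mul_ite, mul_zero]
    rw [← sum_filter, filter_mem_eq_inter, univ_inter]
    refine sum_congr rfl fun S _ => ?_
    rcases Nat.eq_zero_or_pos #S with h | h
    · simp [h]
    · simp only [Polynomial.derivative_X_pow, Polynomial.eval_mul, Polynomial.eval_pow,
        Polynomial.eval_X, map_natCast, Polynomial.eval_natCast]
      rw [← Nat.sub_add_cancel h, pow_succ]
      simp; ring

end EvenSum

/-! ### Inversion parity as a quadratic form over `ZMod 2`. -/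

section InversionForm

variable {ι L L' : Type} [LinearOrder L] [LinearOrder L']

/-- The indicator of `κ e < κ f`, modulo two. -/
def ltInd (κ : ι → L) (e f : ι) : ZMod 2 := if κ e < κ f then 1 else 0

theorem ltInd_self (κ : ι → L) (e : ι) : ltInd κ e e = 0 := by simp [ltInd]

variable [Fintype ι]

/-- The number of inversions between two orders, as a quadratic form modulo two. -/
def invForm (κ : ι → L) (κ' : ι → L') (x : ι → ZMod 2) : ZMod 2 :=
  ∑ e, ∑ f, ltInd κ e f * ltInd κ' f e * (x e * x f)

/-- The polarization of `invForm`. -/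
def invPolar (κ : ι → L) (κ' : ι → L') (x y : ι → ZMod 2) : ZMod 2 :=
  ∑ e, ∑ f, (ltInd κ e f + ltInd κ' e f) * (x e * y f)

/-- Modulo two, a pair of distinct elements is an inversion exactly when the two orders disagree on
it, that is when `[κ e < κ f] + [κ' e < κ' f] = 1`. -/
theorem invForm_add {κ : ι → L} {κ' : ι → L'} (hκ : Function.Injective κ)
    (hκ' : Function.Injective κ') (x y : ι → ZMod 2) :
    invForm κ κ' (x + y) = invForm κ κ' x + invForm κ κ' y + invPolar κ κ' x y := by
  have h : invPolar κ κ' x y = ∑ e, ∑ f, ltInd κ e f * ltInd κ' f e * (x e * y f) +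
      ∑ e, ∑ f, ltInd κ e f * ltInd κ' f e * (y e * x f) := by
    rw [sum_comm (f := fun e f => ltInd κ e f * ltInd κ' f e * (y e * x f)), invPolar,
      ← sum_add_distrib]
    refine sum_congr rfl fun e _ => ?_
    rw [← sum_add_distrib]
    refine sum_congr rfl fun f _ => ?_
    have key : ltInd κ e f + ltInd κ' e f =
        ltInd κ e f * ltInd κ' f e + ltInd κ f e * ltInd κ' e f := by
      by_cases hef : e = f
      · subst hef; simp [ltInd_self]
      · unfold ltInd
        rcases lt_or_gt_of_ne (hκ.ne hef) with h | h <;>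
          rcases lt_or_gt_of_ne (hκ'.ne hef) with h' | h' <;>
          simp [h, h', h.not_gt, h'.not_gt]
        exact CharTwo.add_self_eq_zero 1
    rw [key]; ring
  rw [h]
  simp only [invForm, ← sum_add_distrib, Pi.add_apply]
  refine sum_congr rfl fun e _ => sum_congr rfl fun f _ => ?_
  ring

theorem invPolar_add_right (κ : ι → L) (κ' : ι → L') (x y z : ι → ZMod 2) :
    invPolar κ κ' x (y + z) = invPolar κ κ' x y + invPolar κ κ' x z := by
  simp only [invPolar, ← sum_add_distrib, Pi.add_apply, mul_add]

theorem invPolar_add_left (κ : ι → L) (κ' : ι → L') (x y z : ι → ZMod 2) :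
    invPolar κ κ' (x + y) z = invPolar κ κ' x z + invPolar κ κ' y z := by
  simp only [invPolar, ← sum_add_distrib, Pi.add_apply, mul_add, add_mul]

variable [DecidableEq ι]

theorem invPolar_single (κ : ι → L) (κ' : ι → L') (x : ι → ZMod 2) (f : ι) :
    invPolar κ κ' x (Pi.single f 1) = ∑ e, (ltInd κ e f + ltInd κ' e f) * x e := by
  refine sum_congr rfl fun e _ => ?_
  rw [sum_eq_single f]
  · simp
  · intro g _ hg
    simp [hg]
  · simp

theorem invPolar_single_single (κ : ι → L) (κ' : ι → L') (e f : ι) :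
    invPolar κ κ' (Pi.single e 1) (Pi.single f 1) = ltInd κ e f + ltInd κ' e f := by
  rw [invPolar_single, sum_eq_single e]
  · simp
  · intro g _ hg
    simp [hg]
  · simp

theorem invForm_single (κ : ι → L) (κ' : ι → L') (e : ι) :
    invForm κ κ' (Pi.single e 1) = 0 := by
  refine sum_eq_zero fun f _ => sum_eq_zero fun g _ => ?_
  by_cases hf : f = e
  · by_cases hg : g = e
    · simp [hf, hg, ltInd_self]
    · simp [hg]
  · simp [hf]

theorem inversionSign_eq_one_of_invForm {κ : ι → L} {κ' : ι → L'} {S : Finset ι}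
    (h : invForm κ κ' (fun e => if e ∈ S then 1 else 0) = 0) : inversionSign κ κ' S = 1 := by
  have h1 : inversionSign κ κ' S =
      (-1) ^ ∑ e ∈ S, ∑ f ∈ S, if κ e < κ f ∧ κ' f < κ' e then 1 else 0 := by
    rw [← prod_pow_eq_pow_sum]
    refine prod_congr rfl fun e _ => ?_
    rw [← prod_pow_eq_pow_sum]
    refine prod_congr rfl fun f _ => ?_
    split_ifs <;> simp
  rw [h1]
  refine Even.neg_one_pow ?_
  rw [← ZMod.natCast_eq_zero_iff_even, ← h]
  push_cast
  simp only [invForm, ltInd]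
  rw [← sum_filter_add_sum_filter_not univ (· ∈ S)]
  rw [sum_eq_zero (s := {x | x ∉ S}), add_zero, filter_mem_eq_inter, univ_inter]
  · refine sum_congr rfl fun e he => ?_
    rw [← sum_filter_add_sum_filter_not univ (· ∈ S)]
    rw [sum_eq_zero (s := {x | x ∉ S}), add_zero, filter_mem_eq_inter, univ_inter]
    · refine sum_congr rfl fun f hf => ?_
      by_cases h : κ e < κ f <;> by_cases h' : κ' f < κ' e <;> simp [he, hf, h, h']
    · intro f hf
      simp only [mem_filter] at hf
      simp [hf.2]
  · intro f hf
    simp only [mem_filter] at hf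
    simp [hf.2]

end InversionForm

/-! ### Elementary squares under cyclic orderings. -/

section CyclicBlocks

variable {ι V : Type}

/-- The key ordering edges by block first, then cyclically by direction. -/
def blockKey (code : V → ℕ) (b : ι → V) (w : Bool) (ρ : Fin 4) (δ : ι → Fin 4) (e : ι) : ℕ ×ₗ ℕ :=
  toLex (code (b e), cyclicRank w ρ (δ e))

theorem cyclicRank_injective (w : Bool) (ρ : Fin 4) : Function.Injective (cyclicRank w ρ) := by
  revert w ρ
  unfold Function.Injective
  decide

theorem blockKey_injective {code : V → ℕ} (hcode : Function.Injective code) {b : ι → V}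
    {δ : ι → Fin 4} (hδ : ∀ e f, b e = b f → δ e = δ f → e = f) (w : Bool) (ρ : Fin 4) :
    Function.Injective (blockKey code b w ρ δ) := by
  intro e f h
  have h' := toLex.injective h
  rw [Prod.mk.injEq] at h'
  exact hδ e f (hcode h'.1) (cyclicRank_injective w ρ h'.2)

theorem blockKey_lt_iff_of_eq (code : V → ℕ) {b : ι → V} (w : Bool) (ρ : Fin 4)
    (δ : ι → Fin 4) {e f : ι} (h : b e = b f) :
    blockKey code b w ρ δ e < blockKey code b w ρ δ f ↔
      cyclicRank w ρ (δ e) < cyclicRank w ρ (δ f) := by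
  simp [blockKey, Prod.Lex.toLex_lt_toLex, h]

theorem blockKey_lt_iff_of_ne {code : V → ℕ} (hcode : Function.Injective code) {b : ι → V}
    (w : Bool) (ρ : Fin 4) (δ : ι → Fin 4) {e f : ι} (h : b e ≠ b f) :
    blockKey code b w ρ δ e < blockKey code b w ρ δ f ↔ code (b e) < code (b f) := by
  simp [blockKey, Prod.Lex.toLex_lt_toLex, hcode.ne h]

variable [Fintype ι] [DecidableEq ι]

/-- Two neighbouring directions separate exactly one direction, up to a constant. -/
theorem exists_cyclicRank_separation (w : Bool) (ρ d : Fin 4) : ∃ a : ZMod 2, ∀ d' : Fin 4,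
    ((if cyclicRank w ρ d' < cyclicRank w ρ d then 1 else 0) +
      if cyclicRank w ρ d' < cyclicRank w ρ (d + 1) then 1 else 0) =
      a + if d' = (if w then d + 1 else d) then 1 else 0 := by
  revert w ρ d
  decide

/-- Edges of other blocks compare alike with `f₁` and `f₂` and cancel modulo two. Inside the block
the two comparisons differ by a constant plus the indicator of one edge, and evenness of `x` kills
the constant. The rotational sense decides which of the two edges survives. -/
theorem sum_ltInd_corner [DecidableEq V] {code : V → ℕ} (hcode : Function.Injective code) {b : ι → V}
    {δ : ι → Fin 4} (hδ : ∀ e f, b e = b f → δ e = δ f → e = f) (w : Bool) (ρ : Fin 4)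
    {f₁ f₂ : ι} (hb : b f₂ = b f₁) (hd : δ f₂ = δ f₁ + 1) {x : ι → ZMod 2}
    (hx : ∑ e, (if b e = b f₁ then x e else 0) = 0) :
    ∑ e, (ltInd (blockKey code b w ρ δ) e f₁ + ltInd (blockKey code b w ρ δ) e f₂) * x e =
      x (if w then f₂ else f₁) := by
  obtain ⟨a, ha⟩ := exists_cyclicRank_separation w ρ (δ f₁)
  have h : ∀ e, (ltInd (blockKey code b w ρ δ) e f₁ + ltInd (blockKey code b w ρ δ) e f₂) * x e =
      a * (if b e = b f₁ then x e else 0) + if e = (if w then f₂ else f₁) then x e else 0 := by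
    intro e
    by_cases he : b e = b f₁
    · have he2 : b e = b f₂ := he.trans hb.symm
      have hiff : e = (if w then f₂ else f₁) ↔ δ e = if w then δ f₁ + 1 else δ f₁ := by
        cases w
        · exact ⟨fun h => by simp [h], fun h => hδ _ _ he h⟩
        · exact ⟨fun h => by simp [h, hd], fun h => hδ _ _ he2 (by simpa [hd] using h)⟩
      simp only [ltInd, blockKey_lt_iff_of_eq code w ρ δ he, blockKey_lt_iff_of_eq code w ρ δ he2,
        hd, ha, he, if_true, hiff]
      split_ifs <;> ring
    · have he2 : b e ≠ b f₂ := fun h => he (h.trans hb)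
      have hne : e ≠ (if w then f₂ else f₁) := by
        rintro rfl
        cases w
        · exact he rfl
        · exact he hb
      simp only [ltInd, blockKey_lt_iff_of_ne hcode w ρ δ he,
        blockKey_lt_iff_of_ne hcode w ρ δ he2, he, hne, if_false, hb, CharTwo.add_self_eq_zero]
      ring
  simp only [h]
  rw [sum_add_distrib, ← mul_sum, hx, mul_zero, zero_add, sum_ite_eq']
  simp

/-- Modulo two, the source terms depend only on the parity of `r - d`, and the sink terms depend on
that of `s - d` in the same way, plus one. The sum vanishes precisely because `r` and `s` have
opposite parity: this is where perpendicularity is needed. -/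
theorem cyclicRank_face (w : Bool) (r s d : Fin 4) (hrs : Odd (r.val + s.val)) :
    (if cyclicRank w r d < cyclicRank w r (d + 1) then (1 : ZMod 2) else 0) +
      (if cyclicRank w r (d + 2) < cyclicRank w r (d + 3) then 1 else 0) +
      (if cyclicRank (!w) s (d + 2) < cyclicRank (!w) s (d + 3 + 2) then 1 else 0) +
      (if cyclicRank (!w) s (d + 1 + 2) < cyclicRank (!w) s (d + 2 + 2) then 1 else 0) = 0 := by
  revert w r s d
  decide

/-- Four edges forming an elementary square: `e₁, e₂` leave one corner, `e₃, e₄` the opposite one,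
in consecutive directions. -/
structure IsFace (src tgt : ι → V) (dir : ι → Fin 4) (e₁ e₂ e₃ e₄ : ι) : Prop where
  src₂ : src e₂ = src e₁
  src₄ : src e₄ = src e₃
  src_ne : src e₁ ≠ src e₃
  tgt₄ : tgt e₄ = tgt e₁
  tgt₃ : tgt e₃ = tgt e₂
  tgt_ne : tgt e₁ ≠ tgt e₂
  dir₂ : dir e₂ = dir e₁ + 1
  dir₃ : dir e₃ = dir e₁ + 2
  dir₄ : dir e₄ = dir e₁ + 3

/-- The indicator function of the four edges. -/
def faceVec (e₁ e₂ e₃ e₄ : ι) : ι → ZMod 2 :=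
  Pi.single e₁ 1 + Pi.single e₂ 1 + Pi.single e₃ 1 + Pi.single e₄ 1

variable {src tgt : ι → V} {dir : ι → Fin 4} {e₁ e₂ e₃ e₄ : ι} {code : V → ℕ}

/-- Of the comparisons among the six pairs, those between different blocks occur twice and cancel.
The four corner comparisons are left, and `cyclicRank_face` evaluates them. -/
theorem IsFace.invForm_eq_zero (hF : IsFace src tgt dir e₁ e₂ e₃ e₄)
    (hcode : Function.Injective code) (hs : ∀ e f, src e = src f → dir e = dir f → e = f)
    (ht : ∀ e f, tgt e = tgt f → dir e = dir f → e = f) (w : Bool) (r s : Fin 4)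
    (hrs : Odd (r.val + s.val)) :
    invForm (blockKey code src w r dir) (blockKey code tgt (!w) s fun e => dir e + 2)
      (faceVec e₁ e₂ e₃ e₄) = 0 := by
  have hκ := blockKey_injective hcode hs w r
  have hκ' := blockKey_injective (δ := fun e => dir e + 2) hcode
    (fun e f h h' => ht e f h (add_right_cancel h')) (!w) s
  obtain ⟨h1, h2, h3, h4, h5, h6, h7, h8, h9⟩ := hF
  simp only [faceVec, invForm_add hκ hκ', invPolar_add_left, invForm_single,
    invPolar_single_single]
  have k1 := cyclicRank_face w r s (dir e₁) hrs
  have a13 := blockKey_lt_iff_of_ne hcode w r dir h3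
  have a14 := blockKey_lt_iff_of_ne (b := src) (e := e₁) (f := e₄) hcode w r dir (by rwa [h2])
  have a23 := blockKey_lt_iff_of_ne (b := src) (e := e₂) (f := e₃) hcode w r dir (by rwa [h1])
  have a24 := blockKey_lt_iff_of_ne (b := src) (e := e₂) (f := e₄) hcode w r dir (by rwa [h1, h2])
  have a12 := blockKey_lt_iff_of_eq code w r dir h1.symm
  have a34 := blockKey_lt_iff_of_eq code w r dir h2.symm
  have b12 := blockKey_lt_iff_of_ne hcode (!w) s (fun e => dir e + 2) h6
  have b13 := blockKey_lt_iff_of_ne (b := tgt) (e := e₁) (f := e₃) hcode (!w) s (fun e => dir e + 2)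
    (by rwa [h5])
  have b24 := blockKey_lt_iff_of_ne (b := tgt) (e := e₂) (f := e₄) hcode (!w) s (fun e => dir e + 2)
    (by rw [h4]; exact h6.symm)
  have b34 := blockKey_lt_iff_of_ne (b := tgt) (e := e₃) (f := e₄) hcode (!w) s (fun e => dir e + 2)
    (by rw [h4, h5]; exact h6.symm)
  have b14 := blockKey_lt_iff_of_eq code (!w) s (fun e => dir e + 2) h4.symm
  have b23 := blockKey_lt_iff_of_eq code (!w) s (fun e => dir e + 2) h5.symm
  simp only [ltInd, a13, a14, a23, a24, a12, a34, b12, b13, b24, b34, b14, b23, h1, h2, h4, h5,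
    h7, h8, h9]
  have two : (2 : ZMod 2) = 0 := rfl
  generalize (if code (src e₁) < code (src e₃) then (1 : ZMod 2) else 0) = u1
  generalize (if code (tgt e₁) < code (tgt e₂) then (1 : ZMod 2) else 0) = u2
  generalize (if code (tgt e₂) < code (tgt e₁) then (1 : ZMod 2) else 0) = u3
  linear_combination k1 + (2 * u1 + u2 + u3) * two

/-- Each corner of the square contributes the value of `x` on one of its two edges. Since sinks turn
opposite to sources, the source corners and the sink corners select the same two opposite edges, so
every value occurs twice. -/
theorem IsFace.invPolar_eq_zero [DecidableEq V] (hF : IsFace src tgt dir e₁ e₂ e₃ e₄)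
    (hcode : Function.Injective code) (hs : ∀ e f, src e = src f → dir e = dir f → e = f)
    (ht : ∀ e f, tgt e = tgt f → dir e = dir f → e = f) (w : Bool) (r s : Fin 4)
    {x : ι → ZMod 2} (hxs : ∀ f, ∑ e, (if src e = src f then x e else 0) = 0)
    (hxt : ∀ f, ∑ e, (if tgt e = tgt f then x e else 0) = 0) :
    invPolar (blockKey code src w r dir) (blockKey code tgt (!w) s fun e => dir e + 2) x
      (faceVec e₁ e₂ e₃ e₄) = 0 := by
  have ht' : ∀ e f, tgt e = tgt f → dir e + 2 = dir f + 2 → e = f :=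
    fun e f h h' => ht e f h (add_right_cancel h')
  obtain ⟨h1, h2, h3, h4, h5, h6, h7, h8, h9⟩ := hF
  have c1 := sum_ltInd_corner hcode hs w r h1 h7 (hxs e₁)
  have c2 := sum_ltInd_corner hcode hs w r h2 (by rw [h8, h9, add_assoc]; rfl) (hxs e₃)
  have c3 := sum_ltInd_corner (δ := fun e => dir e + 2) hcode ht' (!w) s h4.symm
    (by simp only [h9, add_assoc]; rfl) (hxt e₄)
  have c4 := sum_ltInd_corner (δ := fun e => dir e + 2) hcode ht' (!w) s h5
    (by simp only [h7, h8, add_assoc]; rfl) (hxt e₂)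
  have two : (2 : ZMod 2) = 0 := rfl
  simp only [faceVec, invPolar_add_right, invPolar_single]
  simp only [add_mul, sum_add_distrib] at c1 c2 c3 c4 ⊢
  cases w
  · simp at c1 c2 c3 c4 ⊢
    linear_combination c1 + c2 + c3 + c4 + (x e₁ + x e₃) * two
  · simp at c1 c2 c3 c4 ⊢
    linear_combination c1 + c2 + c3 + c4 + (x e₂ + x e₄) * two

end CyclicBlocks

/-! ### Edges, faces and cycles of the square lattice. -/

section Lattice

variable {m n : ℕ}

theorem isStep_zero {p q : Site m n} :
    IsStep p 0 q ↔ (q.1 : ℕ) = p.1 + 1 ∧ (q.2 : ℕ) = p.2 := by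
  simp [IsStep, unitStep]; omega

theorem isStep_one {p q : Site m n} :
    IsStep p 1 q ↔ (q.1 : ℕ) = p.1 ∧ (q.2 : ℕ) = p.2 + 1 := by
  simp [IsStep, unitStep]; omega

theorem isStep_two {p q : Site m n} :
    IsStep p 2 q ↔ (p.1 : ℕ) = q.1 + 1 ∧ (q.2 : ℕ) = p.2 := by
  simp [IsStep, unitStep]; omega

theorem isStep_three {p q : Site m n} :
    IsStep p 3 q ↔ (q.1 : ℕ) = p.1 ∧ (p.2 : ℕ) = q.2 + 1 := by
  simp [IsStep, unitStep]; omega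

/-- Enumeration of the sites in which the neighbours to the west and south come first. -/
def siteCode (p : Site m n) : ℕ := (finProdFinEquiv p : Fin (m * n))

theorem siteCode_injective : Function.Injective (siteCode (m := m) (n := n)) :=
  fun _ _ h => finProdFinEquiv.injective (Fin.ext h)

theorem siteCode_eq (p : Site m n) : siteCode p = p.2 + n * p.1 := rfl

theorem siteCode_lt (p : Site m n) : siteCode p < m * n := (finProdFinEquiv p).isLt

theorem siteCode_lt_of_isStep {p q : Site m n} {d : Fin 4} (h : IsStep p d q) :
    (d = 0 ∨ d = 1) ∧ siteCode p < siteCode q ∨ (d = 2 ∨ d = 3) ∧ siteCode q < siteCode p := by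
  have hn : 0 < n := p.2.pos
  simp only [siteCode_eq]
  fin_cases d
  · obtain ⟨h1, h2⟩ := isStep_zero.mp h
    left; simp [h1, h2, mul_add, hn]
  · obtain ⟨h1, h2⟩ := isStep_one.mp h
    left; simp [h1, h2]
  · obtain ⟨h1, h2⟩ := isStep_two.mp h
    right; simp [h1, h2, mul_add, hn]
  · obtain ⟨h1, h2⟩ := isStep_three.mp h
    right; simp [h1, h2]

variable {c : Fin 2}

namespace LatticeEdge

/-- The source of a lattice edge. -/
def src (e : LatticeEdge m n c) : Site m n := e.1.1

/-- The target of a lattice edge. -/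
def tgt (e : LatticeEdge m n c) : Site m n := e.1.2.2

/-- The direction of a lattice edge at its source. -/
def dir (e : LatticeEdge m n c) : Fin 4 := e.1.2.1

theorem isStep (e : LatticeEdge m n c) : IsStep (src e) (dir e) (tgt e) := e.2.2

theorem src_color (e : LatticeEdge m n c) : ((src e).1 + (src e).2 : ℕ) % 2 = c := e.2.1

theorem eq_of_src_dir (e f : LatticeEdge m n c) (h : src e = src f) (h' : dir e = dir f) :
    e = f := by
  have he := isStep e
  have hf := isStep f
  rw [h, h'] at he
  have ht : tgt e = tgt f := by
    ext
    · exact_mod_cast he.1.trans hf.1.symm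
    · exact_mod_cast he.2.trans hf.2.symm
  exact Subtype.ext (Prod.ext h (Prod.ext h' ht))

theorem eq_of_tgt_dir (e f : LatticeEdge m n c) (h : tgt e = tgt f) (h' : dir e = dir f) :
    e = f := by
  have he := isStep e
  have hf := isStep f
  rw [h, h'] at he
  have ht : src e = src f := by
    ext
    · exact_mod_cast add_right_cancel (he.1.symm.trans hf.1)
    · exact_mod_cast add_right_cancel (he.2.symm.trans hf.2)
  exact Subtype.ext (Prod.ext ht (Prod.ext h' h))

theorem tgt_color (e : LatticeEdge m n c) : ((tgt e).1 + (tgt e).2 + 1 : ℕ) % 2 = c := by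
  have h := isStep e
  have h' := src_color e
  generalize dir e = d at h
  fin_cases d
  · obtain ⟨h1, h2⟩ := isStep_zero.mp h; omega
  · obtain ⟨h1, h2⟩ := isStep_one.mp h; omega
  · obtain ⟨h1, h2⟩ := isStep_two.mp h; omega
  · obtain ⟨h1, h2⟩ := isStep_three.mp h; omega

theorem src_ne_tgt (e f : LatticeEdge m n c) : src e ≠ tgt f := by
  intro h
  have h1 := src_color e
  have h2 := tgt_color f
  rw [h] at h1
  omega

/-- Edges are determined by their source, direction and target. -/
def mk (p : Site m n) (d : Fin 4) (q : Site m n) (hc : (p.1 + p.2 : ℕ) % 2 = c)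
    (h : IsStep p d q) : LatticeEdge m n c := ⟨(p, d, q), hc, h⟩

end LatticeEdge

open LatticeEdge

theorem exists_ne_of_sum_eq_zero {ι V : Type} [Fintype ι] [DecidableEq V] {b : ι → V} {v : V}
    {x : ι → ZMod 2} (h : ∑ e, (if b e = v then x e else 0) = 0) {u : ι} (hu : b u = v)
    (hxu : x u ≠ 0) : ∃ u', u' ≠ u ∧ b u' = v ∧ x u' ≠ 0 := by
  by_contra hcon
  push Not at hcon
  rw [sum_eq_single u] at h
  · rw [if_pos hu] at h; exact hxu h
  · intro e _ he
    split_ifs with hb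
    · exact hcon e he hb
    · rfl
  · simp

section Face

variable {e₁ e₂ e₃ e₄ : LatticeEdge m n c}

theorem IsFace.faceVec_eq_one (hF : IsFace src tgt dir e₁ e₂ e₃ e₄) {e : LatticeEdge m n c}
    (he : e = e₁ ∨ e = e₂ ∨ e = e₃ ∨ e = e₄) : faceVec e₁ e₂ e₃ e₄ e = 1 := by
  obtain ⟨h1, h2, h3, h4, h5, h6, h7, h8, h9⟩ := hF
  have n13 : e₁ ≠ e₃ := fun h => h3 (h ▸ rfl)
  have n14 : e₁ ≠ e₄ := fun h => h3 (by rw [h, h2])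
  have n23 : e₂ ≠ e₃ := fun h => h3 (by rw [← h1, h])
  have n24 : e₂ ≠ e₄ := fun h => h3 (by rw [← h1, h, h2])
  have n12 : e₁ ≠ e₂ := fun h => h6 (h ▸ rfl)
  have n34 : e₃ ≠ e₄ := fun h => h6 (by rw [← h4, ← h5, h])
  rcases he with rfl | rfl | rfl | rfl <;>
    simp [faceVec, n13, n14, n23, n24, n12, n34, n13.symm, n14.symm, n23.symm,
      n24.symm, n12.symm, n34.symm]

theorem faceVec_eq_zero {e : LatticeEdge m n c}
    (he : ¬ (e = e₁ ∨ e = e₂ ∨ e = e₃ ∨ e = e₄)) : faceVec e₁ e₂ e₃ e₄ e = 0 := by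
  push Not at he
  simp [faceVec, he]

/-- Vectors modulo two which are even at each site. -/
def IsCycle (x : LatticeEdge m n c → ZMod 2) : Prop :=
  ∀ v, ∑ e, ((if src e = v then x e else 0) + (if tgt e = v then x e else 0)) = 0

theorem IsCycle.add {x y : LatticeEdge m n c → ZMod 2} (hx : IsCycle x) (hy : IsCycle y) :
    IsCycle (x + y) := by
  intro v
  have h := congrArg₂ (· + ·) (hx v) (hy v)
  simp only [← sum_add_distrib, add_zero] at h
  refine Eq.trans (sum_congr rfl fun e _ => ?_) h
  simp only [Pi.add_apply]
  split_ifs <;> ring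

theorem IsFace.isCycle (hF : IsFace src tgt dir e₁ e₂ e₃ e₄) :
    IsCycle (faceVec e₁ e₂ e₃ e₄) := by
  intro v
  obtain ⟨h1, h2, h3, h4, h5, h6, h7, h8, h9⟩ := hF
  have key : ∀ f : LatticeEdge m n c, ∑ e, ((if src e = v then (Pi.single f 1 : _ → ZMod 2) e else 0)
      + (if tgt e = v then (Pi.single f 1 : _ → ZMod 2) e else 0)) =
      (if src f = v then 1 else 0) + (if tgt f = v then 1 else 0) := by
    intro f
    rw [sum_eq_single f]
    · simp
    · intro g _ hg
      simp [hg]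
    · simp
  have : ∑ e, ((if src e = v then faceVec e₁ e₂ e₃ e₄ e else 0) +
      (if tgt e = v then faceVec e₁ e₂ e₃ e₄ e else 0)) =
      ∑ f ∈ ({0, 1, 2, 3} : Finset (Fin 4)), ((if src (![e₁, e₂, e₃, e₄] f) = v then 1 else 0) +
        (if tgt (![e₁, e₂, e₃, e₄] f) = v then 1 else 0)) := by
    simp only [← key]
    rw [sum_comm]
    refine sum_congr rfl fun e _ => ?_
    simp [faceVec]
    split_ifs <;> ring
  rw [this]
  by_cases a₁ : src e₁ = v <;> by_cases a₂ : src e₃ = v <;> by_cases a₃ : tgt e₁ = v <;>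
    by_cases a₄ : tgt e₂ = v <;>
    simp only [Fin.isValue, mem_insert, zero_ne_one, mem_singleton, Fin.reduceEq, or_self,
      not_false_eq_true, sum_insert, Matrix.cons_val, sum_singleton, h1, h2, h4, h5, a₁, a₂, a₃,
      a₄, if_true, if_false] <;> decide

end Face

theorem IsCycle.sum_src {x : LatticeEdge m n c → ZMod 2} (hx : IsCycle x)
    (f : LatticeEdge m n c) : ∑ e, (if src e = src f then x e else 0) = 0 := by
  refine Eq.trans (sum_congr rfl fun e _ => ?_) (hx (src f))
  rw [if_neg (src_ne_tgt f e).symm, add_zero]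

theorem IsCycle.sum_tgt {x : LatticeEdge m n c → ZMod 2} (hx : IsCycle x)
    (f : LatticeEdge m n c) : ∑ e, (if tgt e = tgt f then x e else 0) = 0 := by
  refine Eq.trans (sum_congr rfl fun e _ => ?_) (hx (tgt f))
  rw [if_neg (c := src e = tgt f) (src_ne_tgt e f), zero_add]

/-- The square having the source `v` as its south-west corner. In a full rectangle the fourth corner
exists as soon as the east and north neighbours do. -/
theorem exists_face_of_src {v : Site m n} {e₁ e₂ : LatticeEdge m n c} (h₁ : src e₁ = v)
    (h₂ : src e₂ = v) (d₁ : dir e₁ = 0) (d₂ : dir e₂ = 1) :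
    ∃ e₃ e₄ : LatticeEdge m n c, IsFace src tgt dir e₁ e₂ e₃ e₄ ∧
      siteCode v ≤ siteCode (src e₃) := by
  have s1 := isStep e₁
  have s2 := isStep e₂
  rw [d₁, h₁, isStep_zero] at s1
  rw [d₂, h₂, isStep_one] at s2
  have hv := src_color e₁
  rw [h₁] at hv
  obtain ⟨R, hR1, hR2⟩ : ∃ R : Site m n, (R.1 : ℕ) = (tgt e₁).1 ∧ (R.2 : ℕ) = (tgt e₂).2 :=
    ⟨((tgt e₁).1, (tgt e₂).2), rfl, rfl⟩
  have hc : (R.1 + R.2 : ℕ) % 2 = c := by omega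
  refine ⟨LatticeEdge.mk R 2 (tgt e₂) hc (isStep_two.mpr ?_), LatticeEdge.mk R 3 (tgt e₁) hc (isStep_three.mpr ?_),
    ⟨by rw [h₁, h₂], rfl, ?_, rfl, rfl, ?_, by rw [d₁, d₂]; rfl, by rw [d₁]; rfl,
      by rw [d₁]; rfl⟩, ?_⟩
  · omega
  · omega
  · intro h
    have : (v.1 : ℕ) = R.1 := by rw [show v = R from h₁.symm.trans h]
    omega
  · intro h
    rw [h] at s1
    omega
  · change _ ≤ siteCode R
    simp only [siteCode_eq, hR1, hR2, s1.1, s2.2, mul_add]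
    omega

/-- The same square when its south-west corner `v` is a sink: the edges at `v` now point west and
south into it, and take the places of `e₂` and `e₃`. -/
theorem exists_face_of_tgt {v : Site m n} {e₂ e₃ : LatticeEdge m n c} (h₂ : tgt e₂ = v)
    (h₃ : tgt e₃ = v) (d₂ : dir e₂ = 2) (d₃ : dir e₃ = 3) :
    ∃ e₁ e₄ : LatticeEdge m n c, IsFace src tgt dir e₁ e₂ e₃ e₄ ∧
      siteCode v ≤ siteCode (tgt e₁) := by
  have s2 := isStep e₂
  have s3 := isStep e₃
  rw [d₂, h₂, isStep_two] at s2
  rw [d₃, h₃, isStep_three] at s3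
  obtain ⟨R, hR1, hR2⟩ : ∃ R : Site m n, (R.1 : ℕ) = (src e₂).1 ∧ (R.2 : ℕ) = (src e₃).2 :=
    ⟨((src e₂).1, (src e₃).2), rfl, rfl⟩
  refine ⟨LatticeEdge.mk (src e₂) 1 R (src_color e₂) (isStep_one.mpr ?_),
    LatticeEdge.mk (src e₃) 0 R (src_color e₃) (isStep_zero.mpr ?_),
    ⟨rfl, rfl, ?_, rfl, by rw [h₂, h₃], ?_, d₂, d₃, by change (0 : Fin 4) = 1 + 3; decide⟩, ?_⟩
  · omega
  · omega
  · intro h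
    change src e₂ = src e₃ at h
    rw [h] at s2
    omega
  · intro h
    have : (R.1 : ℕ) = v.1 := by rw [show R = v from h.trans h₂]
    omega
  · change _ ≤ siteCode R
    simp only [siteCode_eq, hR1, hR2, s2.1, s3.2, mul_add]
    omega

end Lattice

/-! ### Elementary squares span the cycles; triviality of the signs. -/

section Lattice

open LatticeEdge

variable {m n : ℕ} {c : Fin 2}

/-- A cycle supported after the site `v` in the lexicographic order is, near `v`, either trivial or
equal to the elementary square to the north-east of `v`. -/
theorem IsCycle.exists_face {x : LatticeEdge m n c → ZMod 2} (hx : IsCycle x) {v : Site m n}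
    (hsupp : ∀ e, x e ≠ 0 → siteCode v ≤ siteCode (src e) ∧ siteCode v ≤ siteCode (tgt e))
    {u : LatticeEdge m n c} (hxu : x u ≠ 0) (hu : src u = v ∨ tgt u = v) :
    ∃ e₁ e₂ e₃ e₄ : LatticeEdge m n c, IsFace src tgt dir e₁ e₂ e₃ e₄ ∧
      (∀ e, src e = v ∨ tgt e = v → x e + faceVec e₁ e₂ e₃ e₄ e = 0) ∧
      ∀ e, faceVec e₁ e₂ e₃ e₄ e ≠ 0 →
        siteCode v ≤ siteCode (src e) ∧ siteCode v ≤ siteCode (tgt e) := by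
  have hone : ∀ e, x e ≠ 0 → x e = 1 := fun e => (Fin.eq_one_of_ne_zero (x e))
  rcases hu with hu | hu
  -- West and south neighbours precede `v`, so the support hypothesis leaves only the east and north
  -- edges at `v`. By parity, `x` uses both or neither.
  · have hdir : ∀ e, src e = v → (dir e = 0 ∨ dir e = 1) ∧ siteCode v ≤ siteCode (tgt e) ∨
        (dir e = 2 ∨ dir e = 3) ∧ x e = 0 := by
      intro e he
      rcases siteCode_lt_of_isStep (isStep e) with ⟨h1, h2⟩ | ⟨h1, h2⟩
      · rw [he] at h2; exact Or.inl ⟨h1, h2.le⟩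
      · refine Or.inr ⟨h1, ?_⟩
        by_contra hne
        rw [he] at h2
        exact absurd (hsupp e hne).2 h2.not_ge
    have hex : ∃ e₁ e₂ : LatticeEdge m n c, (src e₁ = v ∧ dir e₁ = 0 ∧ x e₁ = 1) ∧
        src e₂ = v ∧ dir e₂ = 1 ∧ x e₂ = 1 := by
      obtain ⟨u', hne, hu', hxu'⟩ := exists_ne_of_sum_eq_zero (hx.sum_src u) rfl hxu
      rw [hu] at hu'
      have hd : dir u' ≠ dir u := fun h => hne (eq_of_src_dir _ _ (hu'.trans hu.symm) h)
      have h1 := (hdir u hu).resolve_right fun h => hxu h.2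
      have h2 := (hdir u' hu').resolve_right fun h => hxu' h.2
      rcases h1.1 with h1 | h1 <;> rcases h2.1 with h2 | h2
      · exact absurd (h2.trans h1.symm) hd
      · exact ⟨u, u', ⟨hu, h1, hone _ hxu⟩, hu', h2, hone _ hxu'⟩
      · exact ⟨u', u, ⟨hu', h2, hone _ hxu'⟩, hu, h1, hone _ hxu⟩
      · exact absurd (h2.trans h1.symm) hd
    obtain ⟨e₁, e₂, ⟨hs₁, hd₁, hx₁⟩, hs₂, hd₂, hx₂⟩ := hex
    obtain ⟨e₃, e₄, hF, hR⟩ := exists_face_of_src hs₁ hs₂ hd₁ hd₂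
    refine ⟨e₁, e₂, e₃, e₄, hF, ?_, ?_⟩
    · intro e he
      have he := he.resolve_right fun h => src_ne_tgt e₁ e (hs₁.trans h.symm)
      by_cases h1 : e = e₁
      · rw [hF.faceVec_eq_one (Or.inl h1), h1, hx₁]; rfl
      by_cases h2 : e = e₂
      · rw [hF.faceVec_eq_one (Or.inr (Or.inl h2)), h2, hx₂]; rfl
      have hv3 : src e₃ ≠ v := fun h => hF.src_ne (hs₁.trans h.symm)
      rw [faceVec_eq_zero, add_zero]
      · rcases hdir e he with ⟨hd, -⟩ | h
        · rcases hd with hd | hd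
          · exact absurd (eq_of_src_dir _ _ (he.trans hs₁.symm) (hd.trans hd₁.symm)) h1
          · exact absurd (eq_of_src_dir _ _ (he.trans hs₂.symm) (hd.trans hd₂.symm)) h2
        · exact h.2
      · rintro (h | h | h | h)
        · exact h1 h
        · exact h2 h
        · exact hv3 (h ▸ he)
        · exact hv3 (hF.src₄ ▸ h ▸ he)
    · have t₁ := ((hdir e₁ hs₁).resolve_right fun h => by simp [hx₁] at h).2
      have t₂ := ((hdir e₂ hs₂).resolve_right fun h => by simp [hx₂] at h).2
      intro e he
      have : e = e₁ ∨ e = e₂ ∨ e = e₃ ∨ e = e₄ := by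
        by_contra hcon
        exact he (faceVec_eq_zero hcon)
      rcases this with rfl | rfl | rfl | rfl
      · exact ⟨hs₁ ▸ le_rfl, t₁⟩
      · exact ⟨hs₂ ▸ le_rfl, t₂⟩
      · exact ⟨hR, hF.tgt₃ ▸ t₂⟩
      · exact ⟨hF.src₄ ▸ hR, hF.tgt₄ ▸ t₁⟩
  · have hdir : ∀ e, tgt e = v → (dir e = 2 ∨ dir e = 3) ∧ siteCode v ≤ siteCode (src e) ∨
        (dir e = 0 ∨ dir e = 1) ∧ x e = 0 := by
      intro e he
      rcases siteCode_lt_of_isStep (isStep e) with ⟨h1, h2⟩ | ⟨h1, h2⟩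
      · refine Or.inr ⟨h1, ?_⟩
        by_contra hne
        rw [he] at h2
        exact absurd (hsupp e hne).1 h2.not_ge
      · rw [he] at h2; exact Or.inl ⟨h1, h2.le⟩
    have hex : ∃ e₂ e₃ : LatticeEdge m n c, (tgt e₂ = v ∧ dir e₂ = 2 ∧ x e₂ = 1) ∧
        tgt e₃ = v ∧ dir e₃ = 3 ∧ x e₃ = 1 := by
      obtain ⟨u', hne, hu', hxu'⟩ := exists_ne_of_sum_eq_zero (hx.sum_tgt u) rfl hxu
      rw [hu] at hu'
      have hd : dir u' ≠ dir u := fun h => hne (eq_of_tgt_dir _ _ (hu'.trans hu.symm) h)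
      have h1 := (hdir u hu).resolve_right fun h => hxu h.2
      have h2 := (hdir u' hu').resolve_right fun h => hxu' h.2
      rcases h1.1 with h1 | h1 <;> rcases h2.1 with h2 | h2
      · exact absurd (h2.trans h1.symm) hd
      · exact ⟨u, u', ⟨hu, h1, hone _ hxu⟩, hu', h2, hone _ hxu'⟩
      · exact ⟨u', u, ⟨hu', h2, hone _ hxu'⟩, hu, h1, hone _ hxu⟩
      · exact absurd (h2.trans h1.symm) hd
    obtain ⟨e₂, e₃, ⟨ht₂, hd₂, hx₂⟩, ht₃, hd₃, hx₃⟩ := hex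
    obtain ⟨e₁, e₄, hF, hR⟩ := exists_face_of_tgt ht₂ ht₃ hd₂ hd₃
    refine ⟨e₁, e₂, e₃, e₄, hF, ?_, ?_⟩
    · intro e he
      have he := he.resolve_left fun h => src_ne_tgt e e₂ (h.trans ht₂.symm)
      by_cases h2 : e = e₂
      · rw [hF.faceVec_eq_one (Or.inr (Or.inl h2)), h2, hx₂]; rfl
      by_cases h3 : e = e₃
      · rw [hF.faceVec_eq_one (Or.inr (Or.inr (Or.inl h3))), h3, hx₃]; rfl
      have hv1 : tgt e₁ ≠ v := fun h => hF.tgt_ne (h.trans ht₂.symm)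
      rw [faceVec_eq_zero, add_zero]
      · rcases hdir e he with ⟨hd, -⟩ | h
        · rcases hd with hd | hd
          · exact absurd (eq_of_tgt_dir _ _ (he.trans ht₂.symm) (hd.trans hd₂.symm)) h2
          · exact absurd (eq_of_tgt_dir _ _ (he.trans ht₃.symm) (hd.trans hd₃.symm)) h3
        · exact h.2
      · rintro (h | h | h | h)
        · exact hv1 (h ▸ he)
        · exact h2 h
        · exact h3 h
        · exact hv1 (hF.tgt₄ ▸ h ▸ he)
    · have t₂ := ((hdir e₂ ht₂).resolve_right fun h => by simp [hx₂] at h).2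
      have t₃ := ((hdir e₃ ht₃).resolve_right fun h => by simp [hx₃] at h).2
      intro e he
      have : e = e₁ ∨ e = e₂ ∨ e = e₃ ∨ e = e₄ := by
        by_contra hcon
        exact he (faceVec_eq_zero hcon)
      rcases this with rfl | rfl | rfl | rfl
      · exact ⟨hF.src₂ ▸ t₂, hR⟩
      · exact ⟨t₂, ht₂ ▸ le_rfl⟩
      · exact ⟨t₃, ht₃ ▸ le_rfl⟩
      · exact ⟨hF.src₄ ▸ t₃, hF.tgt₄ ▸ hR⟩

/-- Order of the edges by source. -/
def srcKey (m n : ℕ) (c : Fin 2) (cw : Bool) (r : Fin 4) : LatticeEdge m n c → ℕ ×ₗ ℕ :=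
  blockKey siteCode src cw r dir

/-- Order of the edges by target. -/
def tgtKey (m n : ℕ) (c : Fin 2) (cw : Bool) (s : Fin 4) : LatticeEdge m n c → ℕ ×ₗ ℕ :=
  blockKey siteCode tgt (!cw) s fun e => dir e + 2

theorem srcKey_injective (cw : Bool) (r : Fin 4) : Function.Injective (srcKey m n c cw r) :=
  blockKey_injective siteCode_injective eq_of_src_dir cw r

theorem tgtKey_injective (cw : Bool) (s : Fin 4) : Function.Injective (tgtKey m n c cw s) :=
  blockKey_injective siteCode_injective
    (fun e f h h' => eq_of_tgt_dir e f h (add_right_cancel h')) (!cw) s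

/-- Sweep the sites in lexicographic order. Adding the square north-east of the current site clears
that site, and does not change the form, since the square has value zero and is orthogonal to `x`.
-/
theorem IsCycle.invForm_eq_zero (cw : Bool) (r s : Fin 4) (hrs : Odd (r.val + s.val))
    {x : LatticeEdge m n c → ZMod 2} (hx : IsCycle x) :
    invForm (srcKey m n c cw r) (tgtKey m n c cw s) x = 0 := by
  -- Here `k` is the code of the next site to clear and `t` the number of sites left; edges in the
  -- support of `x` avoid all sites before `k`.
  suffices H : ∀ t k, k + t = m * n → ∀ x : LatticeEdge m n c → ZMod 2, IsCycle x →
      (∀ e, x e ≠ 0 → k ≤ siteCode (src e) ∧ k ≤ siteCode (tgt e)) →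
      invForm (srcKey m n c cw r) (tgtKey m n c cw s) x = 0 from
    H (m * n) 0 (zero_add _) x hx fun _ _ => ⟨Nat.zero_le _, Nat.zero_le _⟩
  intro t
  induction t with
  | zero =>
    intro k hk x _ hsupp
    have h0 : ∀ e, x e = 0 := by
      intro e
      by_contra hne
      have := (hsupp e hne).1
      have := siteCode_lt (src e)
      omega
    simp [invForm, h0]
  | succ t ih =>
    intro k hk x hx hsupp
    obtain ⟨v, rfl⟩ : ∃ v : Site m n, siteCode v = k :=
      ⟨finProdFinEquiv.symm ⟨k, by omega⟩, by simp [siteCode, Nat.mod_add_div]⟩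
    by_cases hv : ∃ u, x u ≠ 0 ∧ (src u = v ∨ tgt u = v)
    · obtain ⟨u, hxu, hu⟩ := hv
      obtain ⟨e₁, e₂, e₃, e₄, hF, hzero, hge⟩ := hx.exists_face hsupp hxu hu
      have hsum := ih (siteCode v + 1) (by omega) (x + faceVec e₁ e₂ e₃ e₄)
        (hx.add hF.isCycle) ?_
      · rw [invForm_add (srcKey_injective cw r) (tgtKey_injective cw s)] at hsum
        have h1 := hF.invForm_eq_zero siteCode_injective eq_of_src_dir eq_of_tgt_dir cw r s hrs
        have h2 := hF.invPolar_eq_zero siteCode_injective eq_of_src_dir eq_of_tgt_dir cw r s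
          hx.sum_src hx.sum_tgt
        unfold srcKey tgtKey at hsum ⊢
        rwa [h1, h2, add_zero, add_zero] at hsum
      · intro e he
        rw [Pi.add_apply] at he
        have hinc : ¬ (src e = v ∨ tgt e = v) := fun h => he (hzero e h)
        push Not at hinc
        have hle : siteCode v ≤ siteCode (src e) ∧ siteCode v ≤ siteCode (tgt e) := by
          by_cases hxe : x e = 0
          · exact hge e (by rwa [hxe, zero_add] at he)
          · exact hsupp e hxe
        exact ⟨lt_of_le_of_ne hle.1 (siteCode_injective.ne hinc.1.symm),
          lt_of_le_of_ne hle.2 (siteCode_injective.ne hinc.2.symm)⟩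
    · refine ih (siteCode v + 1) (by omega) x hx fun e he => ?_
      push Not at hv
      exact ⟨lt_of_le_of_ne (hsupp e he).1 (siteCode_injective.ne (hv e he).1.symm),
        lt_of_le_of_ne (hsupp e he).2 (siteCode_injective.ne (hv e he).2.symm)⟩

theorem inversionSign_eq_one (cw : Bool) (r s : Fin 4) (hrs : Odd (r.val + s.val))
    {S : Finset (LatticeEdge m n c)} (hs : ∀ v, Even #{e ∈ S | src e = v})
    (ht : ∀ v, Even #{e ∈ S | tgt e = v}) :
    inversionSign (srcKey m n c cw r) (tgtKey m n c cw s) S = 1 := by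
  refine inversionSign_eq_one_of_invForm (IsCycle.invForm_eq_zero cw r s hrs fun v => ?_)
  have key : ∀ p : LatticeEdge m n c → Prop, ∀ [DecidablePred p], Even #{e ∈ S | p e} →
      ∑ e, (if p e then (if e ∈ S then (1 : ZMod 2) else 0) else 0) = 0 := by
    intro p _ hp
    rw [← ZMod.natCast_eq_zero_iff_even] at hp
    rw [← sum_filter, sum_ite_mem, sum_const, nsmul_one, ← hp]
    congr 2
    ext e
    simp [and_comm]
  rw [sum_add_distrib, key _ (hs v), key _ (ht v), add_zero]

end Lattice

/-! ### Complex Gaussian integrals under the sole assumption of absolute convergence. -/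

section ComplexGaussian

open Complex

/-- The standard complex Gaussian measure. -/
noncomputable def gaussMeasure : Measure ℂ :=
  volume.withDensity fun z => ENNReal.ofReal (Real.pi⁻¹ * Real.exp (-‖z‖ ^ 2))

instance : SigmaFinite gaussMeasure := SigmaFinite.withDensity_ofReal _

theorem measurable_gaussDensity :
    Measurable fun z : ℂ => ENNReal.ofReal (Real.pi⁻¹ * Real.exp (-‖z‖ ^ 2)) := by
  fun_prop

theorem toReal_gaussDensity_smul (z g : ℂ) :
    (ENNReal.ofReal (Real.pi⁻¹ * Real.exp (-‖z‖ ^ 2))).toReal • g =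
      (Real.pi : ℂ)⁻¹ * (cexp (-(starRingEnd ℂ z * z)) * g) := by
  rw [ENNReal.toReal_ofReal (by positivity), real_smul, ← normSq_eq_conj_mul_self,
    normSq_eq_norm_sq]
  push_cast
  ring

theorem integrable_gaussMeasure_iff {g : ℂ → ℂ} : Integrable g gaussMeasure ↔
    Integrable fun z => (Real.pi : ℂ)⁻¹ * (cexp (-(starRingEnd ℂ z * z)) * g z) := by
  rw [gaussMeasure, integrable_withDensity_iff_integrable_smul' measurable_gaussDensity
    (by simp)]
  simp only [toReal_gaussDensity_smul]

theorem integral_gaussMeasure (g : ℂ → ℂ) : ∫ z, g z ∂gaussMeasure =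
    ∫ z, (Real.pi : ℂ)⁻¹ * (cexp (-(starRingEnd ℂ z * z)) * g z) := by
  rw [gaussMeasure, integral_withDensity_eq_integral_toReal_smul measurable_gaussDensity
    (by simp)]
  simp only [toReal_gaussDensity_smul]

/-- The linear part changes sign under `z ↦ -z`. If `b.re ≤ 0`, one of the values at `z` and `-z`
always has norm at least `1`, so a nonzero constant would be integrable over `ℂ`. -/
theorem re_pos_of_integrable {b u w : ℂ}
    (h : Integrable fun z : ℂ => cexp (-b * (starRingEnd ℂ z * z) + u * starRingEnd ℂ z + w * z)) :
    0 < b.re := by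
  by_contra hb
  push Not at hb
  have h1 := h.norm
  have h2 := h1.comp_neg
  have h3 := h1.add h2
  have h4 : Integrable fun _ : ℂ => (1 : ℝ) := by
    refine h3.mono' aestronglyMeasurable_const (Filter.Eventually.of_forall fun z => ?_)
    simp only [Pi.add_apply, norm_exp, norm_one, map_neg]
    set t := (u * starRingEnd ℂ z + w * z).re with ht
    have e1 : (-b * (starRingEnd ℂ z * z) + u * starRingEnd ℂ z + w * z).re =
        -b.re * normSq z + t := by
      rw [add_assoc, add_re, ← ht, ← normSq_eq_conj_mul_self]
      simp
    have e2 : (-b * (-starRingEnd ℂ z * -z) + u * -starRingEnd ℂ z + w * -z).re =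
        -b.re * normSq z - t := by
      have : (-b * (-starRingEnd ℂ z * -z) + u * -starRingEnd ℂ z + w * -z) =
        -b * (starRingEnd ℂ z * z) - (u * starRingEnd ℂ z + w * z) := by ring
      rw [this, sub_re, ← ht, ← normSq_eq_conj_mul_self]
      simp
    rw [e1, e2]
    have hs : 0 ≤ -b.re * normSq z := mul_nonneg (by linarith) (normSq_nonneg z)
    rcases le_total 0 t with ht | ht
    · have := Real.one_le_exp (x := -b.re * normSq z + t) (by linarith)
      have := Real.exp_pos (-b.re * normSq z - t)
      linarith
    · have := Real.one_le_exp (x := -b.re * normSq z - t) (by linarith)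
      have := Real.exp_pos (-b.re * normSq z + t)
      linarith
  rw [integrable_const_iff] at h4
  rcases h4 with h4 | h4
  · exact one_ne_zero h4
  · have := h4.measure_univ_lt_top
    simp at this

theorem integral_cexp_conj_quadratic {b : ℂ} (hb : 0 < b.re) (u w : ℂ) :
    ∫ z : ℂ, cexp (-b * (starRingEnd ℂ z * z) + u * starRingEnd ℂ z + w * z) =
      Real.pi / b * cexp (u * w / b) := by
  have hb0 : b ≠ 0 := by rintro rfl; simp at hb
  rw [← volume_preserving_equiv_real_prod.symm.integral_comp']
  have h : ∀ p : ℝ × ℝ, cexp (-b * (starRingEnd ℂ (measurableEquivRealProd.symm p) *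
      measurableEquivRealProd.symm p) + u * starRingEnd ℂ (measurableEquivRealProd.symm p) +
      w * measurableEquivRealProd.symm p) =
      cexp (-b * p.1 ^ 2 + (u + w) * p.1 + 0) * cexp (-b * p.2 ^ 2 + I * (w - u) * p.2 + 0) := by
    intro p
    have hz : (measurableEquivRealProd.symm p : ℂ) = p.1 + p.2 * I := by
      rw [measurableEquivRealProd_symm_apply, mk_eq_add_mul_I]
    rw [hz, ← Complex.exp_add]
    congr 1
    simp only [map_add, map_mul, conj_ofReal, conj_I]
    linear_combination b * p.2 ^ 2 * I_sq
  simp only [h]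
  rw [Measure.volume_eq_prod, integral_prod_mul (fun x : ℝ => cexp (-b * x ^ 2 + (u + w) * x + 0))
    (fun x : ℝ => cexp (-b * x ^ 2 + I * (w - u) * x + 0)),
    integral_cexp_quadratic (by simpa using hb), integral_cexp_quadratic (by simpa using hb)]
  have hsq : ((Real.pi : ℂ) / - -b) ^ (1 / 2 : ℂ) * ((Real.pi : ℂ) / - -b) ^ (1 / 2 : ℂ) =
      Real.pi / b := by
    have hne : (Real.pi : ℂ) / b ≠ 0 :=
      div_ne_zero (by exact_mod_cast Real.pi_ne_zero) hb0
    rw [neg_neg, ← cpow_add _ _ hne]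
    norm_num
  rw [mul_mul_mul_comm, hsq, ← Complex.exp_add]
  congr 2
  field_simp
  linear_combination ((w - u) ^ 2) * I_sq

theorem gaussMeasure_cexp {a u w : ℂ} (h : Integrable (fun z : ℂ =>
      cexp (a * (starRingEnd ℂ z * z) + u * starRingEnd ℂ z + w * z)) gaussMeasure) :
    1 - a ≠ 0 ∧ ∫ z, cexp (a * (starRingEnd ℂ z * z) + u * starRingEnd ℂ z + w * z) ∂gaussMeasure =
      (1 - a)⁻¹ * cexp (u * w / (1 - a)) := by
  have hpi : (Real.pi : ℂ) ≠ 0 := by exact_mod_cast Real.pi_ne_zero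
  have hrw : ∀ z : ℂ, cexp (-(starRingEnd ℂ z * z)) *
      cexp (a * (starRingEnd ℂ z * z) + u * starRingEnd ℂ z + w * z) =
      cexp (-(1 - a) * (starRingEnd ℂ z * z) + u * starRingEnd ℂ z + w * z) := by
    intro z
    rw [← Complex.exp_add]
    congr 1
    ring
  rw [integrable_gaussMeasure_iff] at h
  simp only [hrw] at h
  have h' := h.const_mul (Real.pi : ℂ)
  simp only [mul_inv_cancel_left₀ hpi] at h'
  have hb := re_pos_of_integrable h'
  have hb0 : 1 - a ≠ 0 := by intro h0; simp [h0] at hb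
  refine ⟨hb0, ?_⟩
  rw [integral_gaussMeasure]
  simp only [hrw]
  rw [integral_const_mul, integral_cexp_conj_quadratic hb]
  field_simp

theorem integrable_gaussMeasure_one : Integrable (fun _ : ℂ => (1 : ℂ)) gaussMeasure := by
  rw [integrable_gaussMeasure_iff]
  refine Integrable.const_mul ?_ _
  by_contra H
  have h := integral_cexp_conj_quadratic (b := 1) (by simp) 0 0
  simp only [zero_mul, add_zero, neg_mul, one_mul, mul_one] at h H
  -- A non-integrable function has integral `0` by convention, which contradicts the computed value
  -- `π`.
  rw [integral_undef H] at h
  simp only [div_one, Complex.exp_zero, mul_one] at h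
  exact Real.pi_ne_zero (by exact_mod_cast h.symm)

instance : IsProbabilityMeasure gaussMeasure := by
  have hfin : IsFiniteMeasure gaussMeasure :=
    (integrable_const_iff.mp integrable_gaussMeasure_one).resolve_left one_ne_zero
  constructor
  have h := (gaussMeasure_cexp (a := 0) (u := 0) (w := 0)
    (by simp)).2
  simp [Measure.real] at h
  have h' : (gaussMeasure Set.univ).toReal = 1 := by exact_mod_cast h
  rwa [ENNReal.toReal_eq_one_iff] at h'

/-- Row operations clear the rest of column zero and leave the Schur complement of `N 0 0`. -/
theorem det_eq_mul_schur {n : ℕ} (N : Matrix (Fin (n + 1)) (Fin (n + 1)) ℂ) (h : N 0 0 ≠ 0) :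
    N.det = N 0 0 * (Matrix.of fun i j : Fin n =>
      N i.succ j.succ - N i.succ 0 * N 0 j.succ / N 0 0).det := by
  set A : Matrix (Fin (n + 1)) (Fin (n + 1)) ℂ := Matrix.of fun i j =>
    N i j + (Fin.cons 0 (fun k : Fin n => -(N k.succ 0 / N 0 0)) : Fin (n + 1) → ℂ) i * N 0 j
    with hA
  have h1 : A.det = N.det := Matrix.det_eq_of_forall_row_eq_smul_add_const
    (Fin.cons 0 fun k : Fin n => -(N k.succ 0 / N 0 0)) 0 rfl (fun i j => by rw [hA, Matrix.of_apply])
  rw [← h1, Matrix.det_succ_column_zero, Fin.sum_univ_succ, sum_eq_zero, add_zero]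
  · simp only [Fin.val_zero, pow_zero, one_mul]
    congr 1
    · simp [hA]
    · congr 1
      ext i j
      simp [hA]
      ring
  · intro i _
    have : A i.succ 0 = 0 := by
      simp [hA]
      field_simp
      ring
    simp [this]

/-- Gaussian integrals over `ℂⁿ`: absolute convergence forces the determinant not to vanish. -/
theorem gaussian_integral_fin {n : ℕ} (M : Matrix (Fin n) (Fin n) ℂ)
    (h : Integrable (fun x : Fin n → ℂ => cexp (∑ i, ∑ j, starRingEnd ℂ (x i) * M i j * x j))
      (Measure.pi fun _ => gaussMeasure)) :
    (1 - M).det ≠ 0 ∧ ∫ x, cexp (∑ i, ∑ j, starRingEnd ℂ (x i) * M i j * x j)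
      ∂(Measure.pi fun _ => gaussMeasure) = (1 - M).det⁻¹ := by
  induction n with
  | zero => simp
  | succ n ih =>
    have hmp := measurePreserving_piFinSuccAbove (fun _ : Fin (n + 1) => gaussMeasure) 0
    set u : (Fin n → ℂ) → ℂ := fun y => ∑ j, M 0 j.succ * y j with hu
    set w : (Fin n → ℂ) → ℂ := fun y => ∑ i, starRingEnd ℂ (y i) * M i.succ 0 with hw
    set q : (Fin n → ℂ) → ℂ := fun y => ∑ i, ∑ j, starRingEnd ℂ (y i) * M i.succ j.succ * y j
      with hq
    set F : ℂ × (Fin n → ℂ) → ℂ := fun p =>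
      cexp (M 0 0 * (starRingEnd ℂ p.1 * p.1) + u p.2 * starRingEnd ℂ p.1 + w p.2 * p.1) *
        cexp (q p.2) with hF
    have hcomp : (fun x : Fin (n + 1) → ℂ =>
        cexp (∑ i, ∑ j, starRingEnd ℂ (x i) * M i j * x j)) =
        fun x => F (MeasurableEquiv.piFinSuccAbove (fun _ => ℂ) 0 x) := by
      ext x
      simp only [hF, ← Complex.exp_add, MeasurableEquiv.piFinSuccAbove, MeasurableEquiv.coe_mk,
        Fin.insertNthEquiv_zero, Fin.consEquiv_symm_apply, hu, hw, hq]
      congr 1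
      simp only [Fin.sum_univ_succ, Fin.tail, sum_add_distrib, sum_mul]
      have : ∀ i : Fin n, M 0 i.succ * x i.succ * starRingEnd ℂ (x 0) =
        starRingEnd ℂ (x 0) * M 0 i.succ * x i.succ := fun i => by ring
      simp only [this]
      ring
    rw [hcomp] at h ⊢
    have hint : Integrable F (gaussMeasure.prod (Measure.pi fun _ => gaussMeasure)) :=
      (hmp.integrable_comp_emb (MeasurableEquiv.measurableEmbedding _)).mp h
    have hslice : ∀ y, Integrable (fun z => F (z, y)) gaussMeasure →
        1 - M 0 0 ≠ 0 ∧ ∫ z, F (z, y) ∂gaussMeasure =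
          (1 - M 0 0)⁻¹ * (cexp (u y * w y / (1 - M 0 0)) * cexp (q y)) := by
      intro y hy
      have hy' := hy.mul_const (cexp (-q y))
      simp only [hF, ← Complex.exp_add, add_neg_cancel_right] at hy'
      obtain ⟨h1, h2⟩ := gaussMeasure_cexp (a := M 0 0) (u := u y) (w := w y) hy'
      refine ⟨h1, ?_⟩
      simp only [hF]
      rw [integral_mul_const, h2, mul_assoc]
    -- By Fubini almost every slice in the first variable is integrable. A single such slice already
    -- gives `1 - M 0 0 ≠ 0`.
    have hae := hint.prod_left_ae
    obtain ⟨y₀, hy₀⟩ := hae.exists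
    have hb := (hslice y₀ hy₀).1
    -- Chosen so that `1 - M'` is the Schur complement of `1 - M`; the correction comes from the
    -- factor `exp (u w / (1 - M 0 0))` left by the first integration.
    set M' : Matrix (Fin n) (Fin n) ℂ := Matrix.of fun i j =>
      M i.succ j.succ + M i.succ 0 * M 0 j.succ / (1 - M 0 0) with hM'
    have hM'q : ∀ y : Fin n → ℂ, cexp (u y * w y / (1 - M 0 0)) * cexp (q y) =
        cexp (∑ i, ∑ j, starRingEnd ℂ (y i) * M' i j * y j) := by
      intro y
      rw [← Complex.exp_add, mul_comm (u y), hu, hw, hq]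
      congr 1
      simp only [sum_mul_sum, sum_div, ← sum_add_distrib, hM', Matrix.of_apply]
      refine sum_congr rfl fun i _ => sum_congr rfl fun j _ => ?_
      ring
    have hcongr : (fun y => ∫ z, F (z, y) ∂gaussMeasure) =ᵐ[Measure.pi fun _ => gaussMeasure]
        fun y => (1 - M 0 0)⁻¹ * cexp (∑ i, ∑ j, starRingEnd ℂ (y i) * M' i j * y j) := by
      filter_upwards [hae] with y hy
      rw [(hslice y hy).2, hM'q]
    have hint' := (hint.integral_prod_right.congr hcongr).const_mul (1 - M 0 0)
    simp only [mul_inv_cancel_left₀ hb] at hint'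
    obtain ⟨hd, hI⟩ := ih M' hint'
    have hdet : (1 - M).det = (1 - M 0 0) * (1 - M').det := by
      rw [det_eq_mul_schur (1 - M) (by simpa using hb)]
      congr 2
      ext i j
      simp [hM', Matrix.one_apply, (Fin.succ_ne_zero j).symm]
      ring
    rw [hdet]
    refine ⟨mul_ne_zero hb hd, ?_⟩
    rw [hmp.integral_comp' F, integral_prod_symm _ hint, integral_congr_ae hcongr,
      integral_const_mul, hI, mul_inv]

theorem gaussian_integral {ι : Type} [Fintype ι] [DecidableEq ι] (M : Matrix ι ι ℂ)
    (h : Integrable (fun x : ι → ℂ => cexp (∑ i, ∑ j, starRingEnd ℂ (x i) * M i j * x j))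
      (Measure.pi fun _ => gaussMeasure)) :
    (1 - M).det ≠ 0 ∧ ∫ x, cexp (∑ i, ∑ j, starRingEnd ℂ (x i) * M i j * x j)
      ∂(Measure.pi fun _ => gaussMeasure) = (1 - M).det⁻¹ := by
  set e := (Fintype.equivFin ι).symm
  have hmp := measurePreserving_piCongrLeft (α := fun _ => ℂ) (fun _ : ι => gaussMeasure) e
  have hcomp : ∀ x : Fin (Fintype.card ι) → ℂ, cexp (∑ i, ∑ j,
      starRingEnd ℂ (MeasurableEquiv.piCongrLeft (fun _ => ℂ) e x i) * M i j *
        MeasurableEquiv.piCongrLeft (fun _ => ℂ) e x j) =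
      cexp (∑ i, ∑ j, starRingEnd ℂ (x i) * M.submatrix e e i j * x j) := by
    intro x
    have hx : ∀ k, MeasurableEquiv.piCongrLeft (fun _ => ℂ) e x (e k) = x k :=
      fun k => Equiv.piCongrLeft_apply_apply (fun _ => ℂ) e x k
    congr 1
    rw [← e.sum_comp]
    refine sum_congr rfl fun i _ => ?_
    rw [← e.sum_comp]
    refine sum_congr rfl fun j _ => ?_
    rw [hx, hx, Matrix.submatrix_apply]
  have h' := (hmp.integrable_comp_emb (MeasurableEquiv.measurableEmbedding _)).mpr h
  simp only [Function.comp_def, hcomp] at h'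
  have := gaussian_integral_fin _ h'
  rw [show (1 : Matrix (Fin (Fintype.card ι)) (Fin (Fintype.card ι)) ℂ) - M.submatrix e e =
    (1 - M).submatrix e e by
      ext i j; simp [Matrix.one_apply],
    Matrix.det_submatrix_equiv_self] at this
  rw [← hmp.integral_comp']
  simp only [hcomp]
  exact this

end ComplexGaussian

/-! ### From spinor integrals to complex Gaussian integrals. -/

section SpinorMeasure

open Complex

/-- Complex conjugation as a measurable equivalence. -/
noncomputable def conjEquiv : ℂ ≃ᵐ ℂ := conjCLE.toHomeomorph.toMeasurableEquiv

theorem conjEquiv_apply (z : ℂ) : conjEquiv z = starRingEnd ℂ z := rfl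

theorem measurePreserving_conjEquiv : MeasurePreserving conjEquiv gaussMeasure gaussMeasure := by
  have hvol : MeasurePreserving conjEquiv (volume : Measure ℂ) volume :=
    conjLIE.measurePreserving
  refine ⟨conjEquiv.measurable, Measure.ext fun s hs => ?_⟩
  rw [Measure.map_apply conjEquiv.measurable hs, gaussMeasure, withDensity_apply _ hs,
    withDensity_apply _ (conjEquiv.measurable hs),
    ← hvol.setLIntegral_comp_preimage hs measurable_gaussDensity]
  simp [conjEquiv_apply]

theorem spinorMeasure_eq_prod : spinorMeasure = gaussMeasure.prod gaussMeasure := by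
  rw [gaussMeasure, prod_withDensity measurable_gaussDensity measurable_gaussDensity,
    spinorMeasure, Measure.volume_eq_prod]
  congr 1
  ext z
  rw [← ENNReal.ofReal_mul (by positivity)]
  congr 1
  rw [neg_add, Real.exp_add]
  field_simp

variable {E : Type}

/-- The change of variables `(α, β) ↦ (α, β̄)` from spinors to complex vectors. -/
noncomputable def spinorEquiv (E : Type) : (E → Spinor) ≃ᵐ (E ⊕ E → ℂ) :=
  ((MeasurableEquiv.arrowProdEquivProdArrow ℂ ℂ E).trans
    ((MeasurableEquiv.refl _).prodCongr (MeasurableEquiv.piCongrRight fun _ => conjEquiv))).trans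
    (MeasurableEquiv.sumPiEquivProdPi fun _ : E ⊕ E => ℂ).symm

theorem spinorEquiv_inl (z : E → Spinor) (e : E) : spinorEquiv E z (Sum.inl e) = (z e).1 := rfl

theorem spinorEquiv_inr (z : E → Spinor) (e : E) :
    spinorEquiv E z (Sum.inr e) = starRingEnd ℂ (z e).2 := rfl

theorem measurePreserving_spinorEquiv [Fintype E] : MeasurePreserving (spinorEquiv E)
    (Measure.pi fun _ => spinorMeasure) (Measure.pi fun _ => gaussMeasure) := by
  rw [spinorMeasure_eq_prod]
  refine MeasurePreserving.trans (MeasurePreserving.trans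
    (measurePreserving_arrowProdEquivProdArrow ℂ ℂ E (fun _ => gaussMeasure)
      fun _ => gaussMeasure) ?_)
    (measurePreserving_sumPiEquivProdPi_symm fun _ : E ⊕ E => gaussMeasure)
  exact (MeasurePreserving.id _).prod
    (measurePreserving_pi _ _ fun _ => measurePreserving_conjEquiv)

/-- The Gaussian integral of a holomorphic plus an antiholomorphic quadratic form. -/
theorem spinor_gaussian_integral [Fintype E] [DecidableEq E] (A B : Matrix E E ℂ)
    (h : Integrable (fun z : E → Spinor => cexp (∑ e, ∑ f, (A e f * ((z e).1 * (z f).2) +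
      B e f * starRingEnd ℂ ((z e).1 * (z f).2)))) (Measure.pi fun _ => spinorMeasure)) :
    (1 - B * A.transpose).det ≠ 0 ∧
      ∫ z : E → Spinor, cexp (∑ e, ∑ f, (A e f * ((z e).1 * (z f).2) +
        B e f * starRingEnd ℂ ((z e).1 * (z f).2))) ∂(Measure.pi fun _ => spinorMeasure) =
        (1 - B * A.transpose).det⁻¹ := by
  -- With coordinates `α` and `β̄`, both `α_e β_f` and its conjugate are products of one coordinate
  -- with the conjugate of one of the other type, so the matrix is block off-diagonal.
  set M : Matrix (E ⊕ E) (E ⊕ E) ℂ := Matrix.fromBlocks 0 B A.transpose 0 with hM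
  have hcomp : ∀ z : E → Spinor, cexp (∑ e, ∑ f, (A e f * ((z e).1 * (z f).2) +
      B e f * starRingEnd ℂ ((z e).1 * (z f).2))) =
      cexp (∑ i, ∑ j, starRingEnd ℂ (spinorEquiv E z i) * M i j * spinorEquiv E z j) := by
    intro z
    congr 1
    simp only [Fintype.sum_sum_type, hM, Matrix.fromBlocks_apply₁₁, Matrix.fromBlocks_apply₁₂,
      Matrix.fromBlocks_apply₂₁, Matrix.fromBlocks_apply₂₂, Matrix.zero_apply, mul_zero, zero_mul,
      sum_const_zero, zero_add, add_zero, spinorEquiv_inl, spinorEquiv_inr, conj_conj,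
      Matrix.transpose_apply, sum_add_distrib, map_mul]
    rw [sum_comm (f := fun e f => (z e).2 * A f e * (z f).1)]
    refine congrArg₂ (· + ·) ?_ ?_ <;>
    · refine sum_congr rfl fun e _ => sum_congr rfl fun f _ => ?_
      ring
  simp only [hcomp] at h ⊢
  have h' := (measurePreserving_spinorEquiv.integrable_comp_emb
    (spinorEquiv E).measurableEmbedding (g := fun x => cexp (∑ i, ∑ j,
      starRingEnd ℂ (x i) * M i j * x j))).mp h
  have hdet : (1 - M).det = (1 - B * A.transpose).det := by
    have : 1 - M = Matrix.fromBlocks 1 (-B) (-A.transpose) 1 := by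
      rw [hM]
      ext (i | i) (j | j) <;> simp [Matrix.one_apply]
    rw [this, Matrix.det_fromBlocks_one₂₂, neg_mul_neg]
  rw [← hdet, measurePreserving_spinorEquiv.integral_comp' (fun x => cexp (∑ i, ∑ j,
      starRingEnd ℂ (x i) * M i j * x j))]
  exact gaussian_integral M h'

end SpinorMeasure

/-! ### The generating function of an alternating graph. -/

namespace OrderedDigraph

open Complex

variable {V E : Type} (Γ : OrderedDigraph V E)

/-- Every vertex is either a source or a sink. -/
def Alternating : Prop := ∀ e f, Γ.src e ≠ Γ.tgt f

open Classical in
/-- The sign matrix of the orderings at the sources. -/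
noncomputable def srcSign : Matrix E E ℂ :=
  Matrix.of (blockSign (fun e => Γ.rank (Γ.src e) e) Γ.src)

open Classical in
/-- The sign matrix of the orderings at the sinks. -/
noncomputable def tgtSign : Matrix E E ℂ :=
  Matrix.of (blockSign (fun e => Γ.rank (Γ.tgt e) e) Γ.tgt)

theorem bracket_eq (z w : Spinor) : Spinor.bracket z w = z.1 * w.2 - z.2 * w.1 := by
  simp [Spinor.bracket, Spinor.dual]; ring

theorem bracket_dual (z w : Spinor) :
    Spinor.bracket z.dual w.dual = starRingEnd ℂ (z.1 * w.2 - z.2 * w.1) := by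
  rw [bracket_eq]
  simp [Spinor.dual]; ring

theorem sum_antisymm [Fintype E] (b : E → V) [DecidableEq V] (ρ : E → ℕ) (x y : E → ℂ) :
    ∑ e, ∑ f, (if b e = b f ∧ ρ e < ρ f then x e * y f - y e * x f else 0) =
      ∑ e, ∑ f, blockSign ρ b e f * (x e * y f) := by
  have h : ∀ e f, (if b e = b f ∧ ρ e < ρ f then x e * y f - y e * x f else 0) =
      (if b e = b f ∧ ρ e < ρ f then x e * y f else 0) -
      (if b e = b f ∧ ρ e < ρ f then y e * x f else 0) := by
    intro e f; split_ifs <;> ring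
  simp only [h, sum_sub_distrib]
  rw [sum_comm (f := fun e f => if b e = b f ∧ ρ e < ρ f then y e * x f else 0),
    ← sum_sub_distrib]
  refine sum_congr rfl fun e _ => ?_
  rw [← sum_sub_distrib]
  refine sum_congr rfl fun f _ => ?_
  unfold blockSign
  by_cases hb : b e = b f
  · rcases lt_trichotomy (ρ e) (ρ f) with h | h | h
    · simp [hb, h, h.not_gt]
    · simp [hb, h]
    · simp [hb, h, h.not_gt]; ring
  · simp [hb, Ne.symm hb]

variable {Γ}

-- No vertex is both a source and a target, so mixed brackets never occur. A bracket at a sink is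
-- the conjugate of the bracket of the original spinors.
open Classical in
theorem Alternating.integrand_eq_cexp_sum [Fintype V] [Fintype E] (hΓ : Γ.Alternating) (c : ℂ)
    (z : E → Spinor) : Γ.integrand (Γ.homWeight c) z =
      cexp (c * (∑ e, ∑ f,
        (if Γ.src e = Γ.src f ∧ Γ.rank (Γ.src e) e < Γ.rank (Γ.src f) f then
          (z e).1 * (z f).2 - (z e).2 * (z f).1 else 0) +
        starRingEnd ℂ (∑ e, ∑ f,
        (if Γ.tgt e = Γ.tgt f ∧ Γ.rank (Γ.tgt e) e < Γ.rank (Γ.tgt f) f then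
          (z e).1 * (z f).2 - (z e).2 * (z f).1 else 0)))) := by
  rw [integrand, ← Complex.exp_sum]
  congr 1
  rw [sum_comm, map_sum, ← sum_add_distrib, mul_sum]
  refine sum_congr rfl fun e _ => ?_
  rw [sum_comm, map_sum, ← sum_add_distrib, mul_sum]
  refine sum_congr rfl fun f _ => ?_
  have key : ∀ v, (if Γ.LtAt v e f then Γ.homWeight c e f *
      Spinor.bracket (Γ.spinorAt z v e) (Γ.spinorAt z v f) else 0) =
      (if v = Γ.src e then (if Γ.src e = Γ.src f ∧ Γ.rank (Γ.src e) e < Γ.rank (Γ.src f) f then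
          c * ((z e).1 * (z f).2 - (z e).2 * (z f).1) else 0) else 0) +
      (if v = Γ.tgt e then (if Γ.tgt e = Γ.tgt f ∧ Γ.rank (Γ.tgt e) e < Γ.rank (Γ.tgt f) f then
          c * starRingEnd ℂ ((z e).1 * (z f).2 - (z e).2 * (z f).1) else 0) else 0) := by
    intro v
    by_cases hs : v = Γ.src e
    · subst hs
      have ht := hΓ e e
      have htf := (hΓ e f).symm
      by_cases hl : Γ.LtAt (Γ.src e) e f
      · have hw : Γ.homWeight c e f = c := if_pos ⟨_, hl⟩
        obtain ⟨-, h2, h3⟩ := hl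
        have h2 : Γ.src f = Γ.src e := h2.resolve_right htf
        rw [if_pos ⟨Or.inl rfl, Or.inl h2, h3⟩, if_pos rfl, if_neg ht,
          if_pos ⟨h2.symm, by rwa [h2]⟩, hw, spinorAt, spinorAt, if_pos rfl, if_pos h2, bracket_eq,
          add_zero]
      · rw [if_neg hl, if_pos rfl, if_neg ht, if_neg, add_zero]
        rintro ⟨h1, h2⟩
        exact hl ⟨Or.inl rfl, Or.inl h1.symm, by rwa [← h1] at h2⟩
    · rw [if_neg hs, zero_add]
      by_cases ht : v = Γ.tgt e
      · subst ht
        have htf := hΓ f e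
        by_cases hl : Γ.LtAt (Γ.tgt e) e f
        · have hw : Γ.homWeight c e f = c := if_pos ⟨_, hl⟩
          obtain ⟨-, h2, h3⟩ := hl
          have h2 : Γ.tgt f = Γ.tgt e := h2.resolve_left htf
          rw [if_pos ⟨Or.inr rfl, Or.inr h2, h3⟩, if_pos rfl,
            if_pos ⟨h2.symm, by rwa [h2]⟩, hw, spinorAt, spinorAt, if_neg (Ne.symm hs), if_neg htf,
            bracket_dual]
        · rw [if_neg hl, if_pos rfl, if_neg]
          rintro ⟨h1, h2⟩
          exact hl ⟨Or.inr rfl, Or.inr h1.symm, by rwa [← h1] at h2⟩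
      · rw [if_neg ht, if_neg]
        rintro ⟨h1 | h1, -⟩
        · exact hs h1.symm
        · exact ht h1.symm
  simp only [key]
  rw [sum_add_distrib, sum_ite_eq', sum_ite_eq']
  simp only [mem_univ, if_true, apply_ite (starRingEnd ℂ), map_zero, mul_add, mul_ite, mul_zero]

theorem Alternating.integrand_eq [Fintype V] [Fintype E] (hΓ : Γ.Alternating) (c : ℂ)
    (z : E → Spinor) : Γ.integrand (Γ.homWeight c) z =
      cexp (∑ e, ∑ f, ((c • Γ.srcSign) e f * ((z e).1 * (z f).2) +
        (c • Γ.tgtSign) e f * starRingEnd ℂ ((z e).1 * (z f).2))) := by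
  classical
  rw [hΓ.integrand_eq_cexp_sum, sum_antisymm Γ.src (fun e => Γ.rank (Γ.src e) e),
    sum_antisymm Γ.tgt (fun e => Γ.rank (Γ.tgt e) e)]
  congr 1
  have hreal : ∀ (b : E → V) (ρ : E → ℕ) e f, starRingEnd ℂ (blockSign ρ b e f) =
      blockSign ρ b e f := by
    intro b ρ e f
    unfold blockSign
    split_ifs <;> simp
  simp only [map_sum, map_mul, hreal, mul_add, mul_sum, ← sum_add_distrib, srcSign, tgtSign,
    Matrix.smul_apply, Matrix.of_apply, smul_eq_mul]
  refine sum_congr rfl fun e _ => sum_congr rfl fun f _ => ?_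
  ring

theorem transpose_srcSign : Γ.srcSign.transpose = -Γ.srcSign := by
  classical
  ext e f
  simp only [srcSign, Matrix.transpose_apply, Matrix.neg_apply, Matrix.of_apply, blockSign]
  by_cases hb : Γ.src e = Γ.src f
  · rcases lt_trichotomy (Γ.rank (Γ.src f) e) (Γ.rank (Γ.src f) f) with h | h | h
    · simp [hb, h, h.not_gt]
    · simp [hb, h]
    · simp [hb, h, h.not_gt]
  · simp [hb, Ne.symm hb]

/-- The generating function of an alternating graph as a determinant. -/
theorem Alternating.genFun_eq [Fintype V] [Fintype E] [DecidableEq E] (hΓ : Γ.Alternating) (v : ℂ)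
    (h : Γ.Converges (Γ.homWeight (I * v))) :
    (1 - v ^ 2 • (Γ.tgtSign * Γ.srcSign)).det ≠ 0 ∧
      Γ.genFun (Γ.homWeight (I * v)) = (1 - v ^ 2 • (Γ.tgtSign * Γ.srcSign)).det⁻¹ := by
  -- The minus sign of `(I v)² = -v²` cancels the one from the antisymmetry of `srcSign`.
  have hI : ((I * v) • Γ.tgtSign) * ((I * v) • Γ.srcSign).transpose =
      v ^ 2 • (Γ.tgtSign * Γ.srcSign) := by
    rw [Matrix.transpose_smul, transpose_srcSign, Matrix.smul_mul, Matrix.mul_smul, smul_smul,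
      Matrix.mul_neg, smul_neg, ← neg_smul]
    congr 1
    linear_combination -v ^ 2 * I_sq
  have heq := funext (hΓ.integrand_eq (I * v))
  rw [Converges, heq] at h
  rw [genFun, heq, ← hI]
  exact spinor_gaussian_integral _ _ h

end OrderedDigraph

/-! ### Operator norm of the sign matrices. -/

section NormBound

/-- The difference of the two sides is `√2` times a sum of two squares, both zero on a plane; the
constant, `cot² (π/8)`, is therefore optimal. -/
theorem sum_sq_signed_le (a b c d : ℝ) :
    (b + c + d) ^ 2 + (-a + c + d) ^ 2 + (-a - b + d) ^ 2 + (-a - b - c) ^ 2 ≤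
      (1 + √2) ^ 2 * (a ^ 2 + b ^ 2 + c ^ 2 + d ^ 2) := by
  have hs : √2 ^ 2 = 2 := Real.sq_sqrt (by norm_num)
  have h : 0 ≤ √2 * ((√2 * b - (a + c)) ^ 2 + (√2 * d - (c - a)) ^ 2) := by positivity
  have key : (1 + √2) ^ 2 * (a ^ 2 + b ^ 2 + c ^ 2 + d ^ 2) -
      ((b + c + d) ^ 2 + (-a + c + d) ^ 2 + (-a - b + d) ^ 2 + (-a - b - c) ^ 2) =
      √2 * ((√2 * b - (a + c)) ^ 2 + (√2 * d - (c - a)) ^ 2) := by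
    linear_combination (a ^ 2 + b ^ 2 + c ^ 2 + d ^ 2 - √2 * b ^ 2 + 2 * b * (a + c) -
      √2 * d ^ 2 + 2 * d * (c - a)) * hs
  linarith

theorem sum_norm_sq_signed_le (a b c d : ℂ) :
    ‖b + c + d‖ ^ 2 + ‖-a + c + d‖ ^ 2 + ‖-a - b + d‖ ^ 2 + ‖-a - b - c‖ ^ 2 ≤
      (1 + √2) ^ 2 * (‖a‖ ^ 2 + ‖b‖ ^ 2 + ‖c‖ ^ 2 + ‖d‖ ^ 2) := by
  have h1 := sum_sq_signed_le a.re b.re c.re d.re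
  have h2 := sum_sq_signed_le a.im b.im c.im d.im
  simp only [Complex.sq_norm, Complex.normSq_apply, Complex.add_re, Complex.add_im,
    Complex.sub_re, Complex.sub_im, Complex.neg_re, Complex.neg_im]
  linarith

/-- The weights are chosen so that a bound of norm `K` on the second factor yields the same
coefficient `K / 2` on both sides. -/
theorem norm_mul_le_weighted {K : ℝ} (hK : 0 < K) (x w : ℂ) :
    ‖x * w‖ ≤ K / 2 * ‖x‖ ^ 2 + (2 * K)⁻¹ * ‖w‖ ^ 2 := by
  rw [norm_mul]
  have h : K / 2 * ‖x‖ ^ 2 + (2 * K)⁻¹ * ‖w‖ ^ 2 - ‖x‖ * ‖w‖ =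
      (2 * K)⁻¹ * (K * ‖x‖ - ‖w‖) ^ 2 := by
    field_simp
    ring
  have : 0 ≤ (2 * K)⁻¹ * (K * ‖x‖ - ‖w‖) ^ 2 := by positivity
  linarith

/-- The `4 × 4` sign matrix has operator norm `1 + √2`. -/
theorem norm_sum_lt_le (X Y : Fin 4 → ℂ) :
    ‖∑ k, ∑ l, if k < l then X k * Y l - Y k * X l else 0‖ ≤
      (1 + √2) / 2 * ∑ k, (‖X k‖ ^ 2 + ‖Y k‖ ^ 2) := by
  have hK : (0 : ℝ) < 1 + √2 := by positivity
  have hexp : (∑ k, ∑ l, if k < l then X k * Y l - Y k * X l else 0) =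
      X 0 * (Y 1 + Y 2 + Y 3) + X 1 * (-Y 0 + Y 2 + Y 3) + X 2 * (-Y 0 - Y 1 + Y 3) +
        X 3 * (-Y 0 - Y 1 - Y 2) := by
    simp [Fin.sum_univ_four]
    ring
  have hW := mul_le_mul_of_nonneg_left (sum_norm_sq_signed_le (Y 0) (Y 1) (Y 2) (Y 3))
    (show 0 ≤ (2 * (1 + √2))⁻¹ by positivity)
  have hcancel : (2 * (1 + √2))⁻¹ * ((1 + √2) ^ 2 *
      (‖Y 0‖ ^ 2 + ‖Y 1‖ ^ 2 + ‖Y 2‖ ^ 2 + ‖Y 3‖ ^ 2)) =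
      (1 + √2) / 2 * (‖Y 0‖ ^ 2 + ‖Y 1‖ ^ 2 + ‖Y 2‖ ^ 2 + ‖Y 3‖ ^ 2) := by
    field_simp
  rw [hcancel] at hW
  have h0 := norm_mul_le_weighted hK (X 0) (Y 1 + Y 2 + Y 3)
  have h1 := norm_mul_le_weighted hK (X 1) (-Y 0 + Y 2 + Y 3)
  have h2 := norm_mul_le_weighted hK (X 2) (-Y 0 - Y 1 + Y 3)
  have h3 := norm_mul_le_weighted hK (X 3) (-Y 0 - Y 1 - Y 2)
  rw [hexp, Fin.sum_univ_four]
  refine (norm_add₄_le).trans ?_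
  linarith

theorem norm_sq_sum_ite {E : Type} [Fintype E] (P : E → Prop) [DecidablePred P]
    (hP : ∀ e f, P e → P f → e = f) (x : E → ℂ) :
    ‖∑ e, if P e then x e else 0‖ ^ 2 = ∑ e, if P e then ‖x e‖ ^ 2 else 0 := by
  by_cases h : ∃ e, P e
  · obtain ⟨e, he⟩ := h
    rw [sum_eq_single e, sum_eq_single e, if_pos he, if_pos he]
    · exact fun f _ hf => if_neg fun h => hf (hP f e h he)
    · simp
    · exact fun f _ hf => if_neg fun h => hf (hP f e h he)
    · simp
  · push Not at h
    simp [h]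

/-- Each block is spread over four slots indexed by rank, with zeros in the empty ones. Sites of
lower degree are thus covered by the `4 × 4` bound. -/
theorem norm_sum_blocks_le {V E : Type} [Fintype V] [Fintype E] [DecidableEq V] (b : E → V)
    (ρ : E → ℕ) (hρ : ∀ e, ρ e < 4) (hinj : ∀ e f, b e = b f → ρ e = ρ f → e = f)
    (x y : E → ℂ) :
    ‖∑ e, ∑ f, if b e = b f ∧ ρ e < ρ f then x e * y f - y e * x f else 0‖ ≤
      (1 + √2) / 2 * ∑ e, (‖x e‖ ^ 2 + ‖y e‖ ^ 2) := by
  set X : (E → ℂ) → V → Fin 4 → ℂ := fun x v k => ∑ e, if b e = v ∧ ρ e = k then x e else 0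
    with hX
  have hnorm : ∀ x : E → ℂ, ∑ e, ‖x e‖ ^ 2 = ∑ v, ∑ k, ‖X x v k‖ ^ 2 := by
    intro x
    have h1 : ∀ v k, ‖X x v k‖ ^ 2 = ∑ e, if b e = v ∧ ρ e = k then ‖x e‖ ^ 2 else 0 :=
      fun v k => norm_sq_sum_ite _
        (fun e f he hf => hinj e f (he.1.trans hf.1.symm) (he.2.trans hf.2.symm)) x
    simp only [h1]
    simp only [sum_comm (s := (univ : Finset (Fin 4))) (t := (univ : Finset E))]
    rw [sum_comm]
    refine sum_congr rfl fun e _ => ?_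
    rw [sum_eq_single (b e), sum_eq_single ⟨ρ e, hρ e⟩]
    · simp
    · intro k _ hk
      exact if_neg fun h => hk (Fin.ext h.2.symm)
    · simp
    · intro v _ hv
      exact sum_eq_zero fun k _ => if_neg fun h => hv h.1.symm
    · simp
  have hsum : (∑ e, ∑ f, if b e = b f ∧ ρ e < ρ f then x e * y f - y e * x f else 0) =
      ∑ v, ∑ k, ∑ l, if k < l then X x v k * X y v l - X y v k * X x v l else 0 := by
    have h1 : ∀ v (k l : Fin 4), (if k < l then X x v k * X y v l - X y v k * X x v l else 0) =
        ∑ e, ∑ f, if (b e = v ∧ ρ e = k) ∧ (b f = v ∧ ρ f = l) ∧ k < l then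
          x e * y f - y e * x f else 0 := by
      intro v k l
      by_cases hkl : k < l
      · simp only [hX, sum_mul_sum, ← sum_sub_distrib, hkl, if_true, and_true]
        refine sum_congr rfl fun e _ => sum_congr rfl fun f _ => ?_
        by_cases he : b e = v ∧ ρ e = k <;> by_cases hf : b f = v ∧ ρ f = l <;> simp [he, hf]
      · simp [hkl]
    simp only [h1]
    simp only [sum_comm (s := (univ : Finset (Fin 4))) (t := (univ : Finset E))]
    rw [sum_comm (s := (univ : Finset V))]
    refine sum_congr rfl fun e _ => ?_
    rw [sum_comm (s := (univ : Finset V))]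
    refine sum_congr rfl fun f _ => ?_
    rw [sum_eq_single (b e), sum_eq_single ⟨ρ e, hρ e⟩, sum_eq_single ⟨ρ f, hρ f⟩]
    · simp [eq_comm]
    · intro k _ hk
      exact if_neg fun h => hk (Fin.ext h.2.1.2.symm)
    · simp
    · intro k _ hk
      exact sum_eq_zero fun l _ => if_neg fun h => hk (Fin.ext h.1.2.symm)
    · simp
    · intro v _ hv
      exact sum_eq_zero fun k _ => sum_eq_zero fun l _ => if_neg fun h => hv h.1.1.symm
    · simp
  rw [hsum, sum_add_distrib, hnorm x, hnorm y, ← sum_add_distrib, mul_sum]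
  refine (norm_sum_le _ _).trans (sum_le_sum fun v _ => ?_)
  rw [← sum_add_distrib]
  exact norm_sum_lt_le (X x v) (X y v)

end NormBound

/-! ### Absolute convergence in the disc. -/

section Convergence

open Complex

theorem integrable_cexp_gaussMeasure {k : ℝ} (hk : k < 1) :
    Integrable (fun z : ℂ => cexp (k * (starRingEnd ℂ z * z))) gaussMeasure := by
  rw [integrable_gaussMeasure_iff]
  refine Integrable.const_mul ?_ _
  have hre : 0 < ((1 : ℂ) - k).re := by simpa using hk
  have hne : (1 : ℂ) - k ≠ 0 := by intro h; simp [h] at hre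
  by_contra H
  have h := integral_cexp_conj_quadratic hre 0 0
  rw [integral_undef] at h
  · simp only [mul_zero, zero_div, Complex.exp_zero, mul_one] at h
    exact div_ne_zero (by exact_mod_cast Real.pi_ne_zero) hne h.symm
  · convert H using 2
    ext z
    rw [← Complex.exp_add]
    congr 1
    ring

theorem norm_cexp_conj (k : ℝ) (z : ℂ) :
    ‖cexp (k * (starRingEnd ℂ z * z))‖ = Real.exp (k * ‖z‖ ^ 2) := by
  rw [← normSq_eq_conj_mul_self, normSq_eq_norm_sq, norm_exp]
  congr 1
  rw [← ofReal_mul, ofReal_re]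

/-- Source terms and sink terms each contribute at most `(1 + √2) / 2` times the sum of the squared
norms. The exponent is then dominated by `k` times that sum, with `k = ‖c‖ (1 + √2) < 1`. -/
theorem OrderedDigraph.Alternating.converges {V E : Type} [Fintype V] [Fintype E]
    {Γ : OrderedDigraph V E} (hΓ : Γ.Alternating) (hs : ∀ e, Γ.rank (Γ.src e) e < 4)
    (ht : ∀ e, Γ.rank (Γ.tgt e) e < 4) {c : ℂ} (hc : ‖c‖ < √2 - 1) :
    Γ.Converges (Γ.homWeight c) := by
  classical
  have hs2 : √2 ^ 2 = 2 := Real.sq_sqrt (by norm_num)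
  set k : ℝ := ‖c‖ * (1 + √2) with hk
  have hk1 : k < 1 := by
    have : ‖c‖ * (1 + √2) < (√2 - 1) * (1 + √2) := by gcongr
    nlinarith
  have hG : Integrable (fun z : E → Spinor => ∏ e, (cexp (k * (starRingEnd ℂ (z e).1 * (z e).1)) *
      cexp (k * (starRingEnd ℂ (z e).2 * (z e).2)))) (Measure.pi fun _ => spinorMeasure) := by
    rw [spinorMeasure_eq_prod]
    exact Integrable.fintype_prod (f := fun _ (ζ : ℂ × ℂ) =>
      cexp (k * (starRingEnd ℂ ζ.1 * ζ.1)) * cexp (k * (starRingEnd ℂ ζ.2 * ζ.2)))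
      fun _ => (integrable_cexp_gaussMeasure hk1).mul_prod (integrable_cexp_gaussMeasure hk1)
  refine hG.mono ?_ (Filter.Eventually.of_forall fun z => ?_)
  · rw [funext (hΓ.integrand_eq c)]
    exact Continuous.aestronglyMeasurable (by fun_prop)
  · rw [hΓ.integrand_eq_cexp_sum, norm_prod]
    simp only [norm_mul, norm_cexp_conj, ← Real.exp_add, ← mul_add]
    rw [← Real.exp_sum, ← mul_sum]
    refine (norm_exp_le_exp_norm _).trans (Real.exp_le_exp.mpr ?_)
    rw [norm_mul, hk, mul_assoc]
    refine mul_le_mul_of_nonneg_left ((norm_add_le _ _).trans ?_) (norm_nonneg _)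
    rw [RCLike.norm_conj]
    have h1 := norm_sum_blocks_le Γ.src (fun e => Γ.rank (Γ.src e) e) hs
      (fun e f h h' => Γ.rank_inj (Γ.src e) e f (Or.inl rfl) (Or.inl h.symm)
        (by simpa [h] using h')) (fun e => (z e).1) (fun e => (z e).2)
    have h2 := norm_sum_blocks_le Γ.tgt (fun e => Γ.rank (Γ.tgt e) e) ht
      (fun e f h h' => Γ.rank_inj (Γ.tgt e) e f (Or.inr rfl) (Or.inr h.symm)
        (by simpa [h] using h')) (fun e => (z e).1) (fun e => (z e).2)
    linarith

end Convergence

/-! ### Even subgraphs and the high temperature expansion. -/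

namespace OrderedDigraph

variable {V E : Type} (Γ : OrderedDigraph V E) [Fintype E]

open Classical in
/-- The sets of edges which meet every vertex an even number of times. -/
noncomputable def evenSets : Finset (Finset E) := {S | ∀ v, Even #{e ∈ S | Γ.Inc e v}}

open Classical in
theorem mem_evenSets {S : Finset E} : S ∈ Γ.evenSets ↔ ∀ v, Even #{e ∈ S | Γ.Inc e v} := by
  simp [evenSets]

theorem evenSum_eq [Fintype V] (v : ℂ) : Γ.evenSum v = ∑ S ∈ Γ.evenSets, v ^ #S := by
  classical
  have h0 : Γ.evenCount 0 = 1 := by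
    rw [evenCount, card_eq_one]
    refine ⟨∅, ?_⟩
    ext S
    simp only [mem_filter, mem_univ, true_and, mem_singleton, card_eq_zero]
    constructor
    · exact fun h => h.1
    · rintro rfl
      simp
  have h1 : ∀ P, (Γ.evenCount P : ℂ) * v ^ P = ∑ S ∈ Γ.evenSets with #S = P, v ^ #S := by
    intro P
    rw [sum_congr rfl (g := fun _ => v ^ P) fun S hS => by rw [(mem_filter.mp hS).2], sum_const,
      nsmul_eq_mul, evenCount, evenSets, filter_filter]
    congr 3
    ext S
    simp only [mem_filter]
    tauto
  have h2 : ∑ S ∈ Γ.evenSets, v ^ #S =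
      ∑ P ∈ range (Fintype.card E + 1), ∑ S ∈ Γ.evenSets with #S = P, v ^ #S := by
    refine (sum_fiberwise_of_maps_to (fun S _ => ?_) _).symm
    rw [mem_range]
    exact Nat.lt_succ_of_le (card_le_univ S)
  rw [h2, sum_range_succ', ← h1 0, h0, evenSum, add_comm]
  simp only [← h1]
  congr 1
  · rw [range_eq_Ico, sum_Ico_add' (fun P => (Γ.evenCount P : ℂ) * v ^ P)]
    rfl
  · simp

theorem exp_mul_spin (K s : ℝ) (hs : s = 1 ∨ s = -1) :
    Real.exp (K * s) = Real.cosh K * (1 + Real.tanh K * s) := by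
  have hc : Real.cosh K ≠ 0 := (Real.cosh_pos K).ne'
  rw [Real.tanh_eq_sinh_div_cosh]
  rcases hs with rfl | rfl
  · field_simp
    rw [Real.cosh_add_sinh]
  · field_simp
    rw [← Real.cosh_sub_sinh, sub_eq_add_neg]

theorem sum_spin_pow (k : ℕ) : ∑ s : ℤˣ, ((s : ℤ) : ℝ) ^ k = if Even k then 2 else 0 := by
  have : (univ : Finset ℤˣ) = {1, -1} := by decide
  rw [this, sum_insert (by decide), sum_singleton]
  split_ifs with h
  · simp [h.neg_one_pow]; norm_num
  · simp [(Nat.not_even_iff_odd.mp h).neg_one_pow]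

variable [Fintype V]

-- The spin at `v` occurs to the power of the degree of `v` in `S`, so summing over it gives `2` for
-- even degree and `0` for odd degree.
open Classical in
theorem sum_prod_spins (S : Finset E) :
    ∑ σ : V → ℤˣ, ∏ e ∈ S, (((σ (Γ.src e) : ℤ) : ℝ) * ((σ (Γ.tgt e) : ℤ) : ℝ)) =
      if S ∈ Γ.evenSets then 2 ^ Fintype.card V else 0 := by
  have h : ∀ σ : V → ℤˣ, ∏ e ∈ S, (((σ (Γ.src e) : ℤ) : ℝ) * ((σ (Γ.tgt e) : ℤ) : ℝ)) =
      ∏ v, ((σ v : ℤ) : ℝ) ^ #{e ∈ S | Γ.Inc e v} := by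
    intro σ
    have h1 : ∀ v, ((σ v : ℤ) : ℝ) ^ #{e ∈ S | Γ.Inc e v} =
        ∏ e ∈ S, if Γ.Inc e v then ((σ v : ℤ) : ℝ) else 1 := by
      intro v
      rw [← prod_filter, prod_const]
    simp only [h1]
    rw [prod_comm]
    refine prod_congr rfl fun e _ => ?_
    rw [← prod_filter]
    have : ({v | Γ.Inc e v} : Finset V) = {Γ.src e, Γ.tgt e} := by
      ext v
      simp [Inc, eq_comm]
    rw [this, prod_pair (Γ.src_ne_tgt e)]
  simp only [h]
  rw [← Fintype.prod_sum fun v (s : ℤˣ) => ((s : ℤ) : ℝ) ^ #{e ∈ S | Γ.Inc e v}]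
  simp only [sum_spin_pow]
  split_ifs with hS
  · have hS' : ∀ v, Even #{e ∈ S | Γ.Inc e v} := by simpa [evenSets] using hS
    rw [prod_congr rfl fun v _ => if_pos (hS' v)]
    simp
  · have hS' : ∃ v, ¬ Even #{e ∈ S | Γ.Inc e v} := by
      simpa [evenSets] using hS
    obtain ⟨v, hv⟩ := hS'
    exact prod_eq_zero (mem_univ v) (if_neg hv)

/-- The high temperature expansion of the Ising partition function. -/
theorem isingZ_eq (K : ℝ) : Γ.isingZ K =
    Real.cosh K ^ Fintype.card E * (2 ^ Fintype.card V *
      ∑ S ∈ Γ.evenSets, Real.tanh K ^ #S) := by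
  classical
  have h : ∀ σ : V → ℤˣ,
      Real.exp (K * ∑ e : E, ((σ (Γ.src e) : ℤ) : ℝ) * ((σ (Γ.tgt e) : ℤ) : ℝ)) =
      Real.cosh K ^ Fintype.card E * ∑ S : Finset E, Real.tanh K ^ #S *
        ∏ e ∈ S, (((σ (Γ.src e) : ℤ) : ℝ) * ((σ (Γ.tgt e) : ℤ) : ℝ)) := by
    intro σ
    rw [mul_sum, Real.exp_sum]
    have h1 : ∀ e, Real.exp (K * (((σ (Γ.src e) : ℤ) : ℝ) * ((σ (Γ.tgt e) : ℤ) : ℝ))) =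
        Real.cosh K * (1 + Real.tanh K * (((σ (Γ.src e) : ℤ) : ℝ) *
          ((σ (Γ.tgt e) : ℤ) : ℝ))) := by
      intro e
      refine exp_mul_spin K _ ?_
      rcases Int.units_eq_one_or (σ (Γ.src e)) with h | h <;>
        rcases Int.units_eq_one_or (σ (Γ.tgt e)) with h' | h' <;> simp [h, h']
    simp only [h1]
    rw [prod_mul_distrib, prod_const, card_univ, prod_one_add, powerset_univ]
    simp only [prod_mul_distrib, prod_const]
  rw [isingZ]
  simp only [h]
  rw [← mul_sum, sum_comm]
  simp only [← mul_sum, Γ.sum_prod_spins, mul_ite, mul_zero]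
  rw [← sum_filter, filter_mem_eq_inter, univ_inter, ← sum_mul, mul_comm (2 ^ _)]

end OrderedDigraph

/-! ### Number of lattice edges. -/

section EdgeCount

open LatticeEdge

variable {m n : ℕ}

/-- The edge joining `p` to its neighbour `q` in direction `d`. -/
def edgeBetween (c : Fin 2) (p : Site m n) (d : Fin 4) (q : Site m n) (h : IsStep p d q)
    (h' : IsStep q (d + 2) p) : LatticeEdge m n c :=
  if hp : (p.1 + p.2 : ℕ) % 2 = c then LatticeEdge.mk p d q hp h
  else LatticeEdge.mk q (d + 2) p (by
    have hd : IsStep p d q := h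
    have := c.isLt
    fin_cases d
    · obtain ⟨h1, h2⟩ := isStep_zero.mp hd; omega
    · obtain ⟨h1, h2⟩ := isStep_one.mp hd; omega
    · obtain ⟨h1, h2⟩ := isStep_two.mp hd; omega
    · obtain ⟨h1, h2⟩ := isStep_three.mp hd; omega) h'

/-- The edges of the lattice, listed by their lower left endpoint. -/
def edgeOfCorner (c : Fin 2) :
    (Fin m × Fin (n - 1)) ⊕ (Fin n × Fin (m - 1)) → LatticeEdge m n c
  | Sum.inl (i, j) => edgeBetween c (i, ⟨j, by omega⟩) 1 (i, ⟨j + 1, by omega⟩)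
      (isStep_one.mpr ⟨rfl, rfl⟩) (isStep_three.mpr ⟨rfl, rfl⟩)
  | Sum.inr (j, i) => edgeBetween c (⟨i, by omega⟩, j) 0 (⟨i + 1, by omega⟩, j)
      (isStep_zero.mpr ⟨rfl, rfl⟩) (isStep_two.mpr ⟨rfl, rfl⟩)

theorem edgeBetween_eq_iff {c : Fin 2} {p q : Site m n} {d : Fin 4} (h : IsStep p d q)
    (h' : IsStep q (d + 2) p) (e : LatticeEdge m n c) : edgeBetween c p d q h h' = e ↔
      (src e = p ∧ dir e = d ∧ tgt e = q) ∨ (src e = q ∧ dir e = d + 2 ∧ tgt e = p) := by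
  unfold edgeBetween
  constructor
  · rintro rfl
    split_ifs
    · exact Or.inl ⟨rfl, rfl, rfl⟩
    · exact Or.inr ⟨rfl, rfl, rfl⟩
  · rintro (⟨h1, h2, -⟩ | ⟨h1, h2, h3⟩)
    · have hc := src_color e
      rw [h1] at hc
      rw [dif_pos hc]
      exact eq_of_src_dir _ _ h1.symm h2.symm
    · have hc := tgt_color e
      rw [h3] at hc
      rw [dif_neg (by omega)]
      exact eq_of_src_dir _ _ h1.symm h2.symm

theorem edgeOfCorner_inl_iff {c : Fin 2} (x : Fin m × Fin (n - 1)) (e : LatticeEdge m n c) :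
    edgeOfCorner c (Sum.inl x) = e ↔
      (((src e).1 : ℕ) = x.1 ∧ ((src e).2 : ℕ) = x.2 ∧ dir e = 1) ∨
      (((tgt e).1 : ℕ) = x.1 ∧ ((tgt e).2 : ℕ) = x.2 ∧ dir e = 3) := by
  have he := isStep e
  rw [edgeOfCorner, edgeBetween_eq_iff]
  simp only [Prod.ext_iff, Fin.ext_iff (n := m), Fin.ext_iff (n := n)]
  refine or_congr ⟨fun h => ⟨h.1.1, h.1.2, h.2.1⟩, fun h => ?_⟩
    ⟨fun h => ⟨h.2.2.1, h.2.2.2, h.2.1⟩, fun h => ?_⟩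
  · rw [h.2.2, isStep_one] at he
    exact ⟨⟨h.1, h.2.1⟩, h.2.2, by omega, by omega⟩
  · rw [h.2.2, isStep_three] at he
    exact ⟨⟨by omega, by omega⟩, h.2.2, h.1, h.2.1⟩

theorem edgeOfCorner_inr_iff {c : Fin 2} (x : Fin n × Fin (m - 1)) (e : LatticeEdge m n c) :
    edgeOfCorner c (Sum.inr x) = e ↔
      (((src e).1 : ℕ) = x.2 ∧ ((src e).2 : ℕ) = x.1 ∧ dir e = 0) ∨
      (((tgt e).1 : ℕ) = x.2 ∧ ((tgt e).2 : ℕ) = x.1 ∧ dir e = 2) := by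
  have he := isStep e
  rw [edgeOfCorner, edgeBetween_eq_iff]
  simp only [Prod.ext_iff, Fin.ext_iff (n := m), Fin.ext_iff (n := n)]
  refine or_congr ⟨fun h => ⟨h.1.1, h.1.2, h.2.1⟩, fun h => ?_⟩
    ⟨fun h => ⟨h.2.2.1, h.2.2.2, h.2.1⟩, fun h => ?_⟩
  · rw [h.2.2, isStep_zero] at he
    exact ⟨⟨h.1, h.2.1⟩, h.2.2, by omega, by omega⟩
  · rw [h.2.2, isStep_two] at he
    exact ⟨⟨by omega, by omega⟩, h.2.2, h.1, h.2.1⟩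

/-- Odd directions are vertical and even ones horizontal. Directions `0` and `1` have the lower left
endpoint as source, and `2` and `3` have it as target. -/
theorem edgeOfCorner_bijective (c : Fin 2) :
    Function.Bijective (edgeOfCorner (m := m) (n := n) c) := by
  constructor
  · rintro (x | x) (y | y) h
    · obtain ⟨e, he⟩ : ∃ e, edgeOfCorner c (Sum.inl y) = e := ⟨_, rfl⟩
      rw [he] at h
      rw [edgeOfCorner_inl_iff] at h he
      congr 1
      rcases h with h | h <;> rcases he with h' | h' <;>
        first
        | exact absurd (h.2.2.symm.trans h'.2.2) (by decide)
        | (ext <;> omega)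
    · obtain ⟨e, he⟩ : ∃ e, edgeOfCorner c (Sum.inr y) = e := ⟨_, rfl⟩
      rw [he] at h
      rw [edgeOfCorner_inl_iff] at h
      rw [edgeOfCorner_inr_iff] at he
      rcases h with h | h <;> rcases he with h' | h' <;>
        exact absurd (h.2.2.symm.trans h'.2.2) (by decide)
    · obtain ⟨e, he⟩ : ∃ e, edgeOfCorner c (Sum.inl y) = e := ⟨_, rfl⟩
      rw [he] at h
      rw [edgeOfCorner_inr_iff] at h
      rw [edgeOfCorner_inl_iff] at he
      rcases h with h | h <;> rcases he with h' | h' <;>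
        exact absurd (h.2.2.symm.trans h'.2.2) (by decide)
    · obtain ⟨e, he⟩ : ∃ e, edgeOfCorner c (Sum.inr y) = e := ⟨_, rfl⟩
      rw [he] at h
      rw [edgeOfCorner_inr_iff] at h he
      congr 1
      rcases h with h | h <;> rcases he with h' | h' <;>
        first
        | exact absurd (h.2.2.symm.trans h'.2.2) (by decide)
        | (ext <;> omega)
  · intro e
    have he := isStep e
    have hd : dir e = 0 ∨ dir e = 1 ∨ dir e = 2 ∨ dir e = 3 := by
      generalize dir e = d
      revert d
      decide
    rcases hd with hd | hd | hd | hd <;> rw [hd] at he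
    · rw [isStep_zero] at he
      exact ⟨Sum.inr ((src e).2, ⟨(src e).1, by omega⟩),
        (edgeOfCorner_inr_iff _ _).mpr (Or.inl ⟨rfl, rfl, hd⟩)⟩
    · rw [isStep_one] at he
      exact ⟨Sum.inl ((src e).1, ⟨(src e).2, by omega⟩),
        (edgeOfCorner_inl_iff _ _).mpr (Or.inl ⟨rfl, rfl, hd⟩)⟩
    · rw [isStep_two] at he
      exact ⟨Sum.inr ((tgt e).2, ⟨(tgt e).1, by omega⟩),
        (edgeOfCorner_inr_iff _ _).mpr (Or.inr ⟨rfl, rfl, hd⟩)⟩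
    · rw [isStep_three] at he
      exact ⟨Sum.inl ((tgt e).1, ⟨(tgt e).2, by omega⟩),
        (edgeOfCorner_inl_iff _ _).mpr (Or.inr ⟨rfl, rfl, hd⟩)⟩

theorem card_latticeEdge (c : Fin 2) :
    Fintype.card (LatticeEdge m n c) = m * (n - 1) + n * (m - 1) := by
  rw [← Fintype.card_of_bijective (edgeOfCorner_bijective c)]
  simp

end EdgeCount

/-! ### Assembly for the square lattice. -/

section SquareLattice

open LatticeEdge

variable {m n : ℕ} {c : Fin 2} (cw : Bool) (r s : Fin 4)

theorem squareLattice_alternating : (squareLattice m n c cw r s).Alternating := src_ne_tgt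

theorem rank_src (e : LatticeEdge m n c) :
    (squareLattice m n c cw r s).rank (src e) e = cyclicRank cw r (dir e) := if_pos rfl

theorem rank_tgt (e : LatticeEdge m n c) :
    (squareLattice m n c cw r s).rank (tgt e) e = cyclicRank (!cw) s (dir e + 2) :=
  if_neg (src_ne_tgt e e)

theorem cyclicRank_lt (cw : Bool) (r d : Fin 4) : cyclicRank cw r d < 4 := by
  unfold cyclicRank
  split_ifs <;> omega

/-- Only comparisons inside a block matter. The local ranks, which order edges at one site, can
therefore be replaced by the injective global keys of the fermionic argument. -/
theorem blockSign_congr {ι L L' V : Type} [LinearOrder L] [LinearOrder L'] [DecidableEq V]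
    {κ : ι → L} {κ' : ι → L'} {b : ι → V}
    (h : ∀ i j, b i = b j → (κ i < κ j ↔ κ' i < κ' j)) : blockSign κ b = blockSign κ' b := by
  ext i j
  unfold blockSign
  by_cases hb : b i = b j
  · simp [hb, h i j hb, h j i hb.symm]
  · simp [hb]

theorem srcSign_squareLattice : (squareLattice m n c cw r s).srcSign =
    Matrix.of (blockSign (srcKey m n c cw r) src) := by
  classical
  have h : ∀ e f : LatticeEdge m n c, src e = src f →
      ((squareLattice m n c cw r s).rank (src e) e < (squareLattice m n c cw r s).rank (src f) f ↔
        srcKey m n c cw r e < srcKey m n c cw r f) := by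
    intro e f hef
    rw [rank_src, rank_src]
    exact (blockKey_lt_iff_of_eq siteCode cw r dir hef).symm
  rw [OrderedDigraph.srcSign]
  congr 1
  convert blockSign_congr h <;> rfl

theorem tgtSign_squareLattice : (squareLattice m n c cw r s).tgtSign =
    Matrix.of (blockSign (tgtKey m n c cw s) tgt) := by
  classical
  have h : ∀ e f : LatticeEdge m n c, tgt e = tgt f →
      ((squareLattice m n c cw r s).rank (tgt e) e < (squareLattice m n c cw r s).rank (tgt f) f ↔
        tgtKey m n c cw s e < tgtKey m n c cw s f) := by
    intro e f hef
    rw [rank_tgt, rank_tgt]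
    exact (blockKey_lt_iff_of_eq siteCode (!cw) s (fun e => dir e + 2) hef).symm
  rw [OrderedDigraph.tgtSign]
  congr 1
  convert blockSign_congr h <;> rfl

/-- At each site one of the two counts is zero, so even degree is the same as both counts being
even. -/
theorem mem_evenSets_squareLattice (S : Finset (LatticeEdge m n c)) :
    S ∈ (squareLattice m n c cw r s).evenSets ↔
      (∀ v, Even #{e ∈ S | src e = v}) ∧ ∀ v, Even #{e ∈ S | tgt e = v} := by
  classical
  have hcard : ∀ v, #{e ∈ S | (squareLattice m n c cw r s).Inc e v} =
      #{e ∈ S | src e = v} + #{e ∈ S | tgt e = v} := by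
    intro v
    rw [← card_union_of_disjoint, ← filter_or]
    · congr 1
      ext e
      simp only [mem_filter]
      rfl
    · rw [disjoint_filter]
      rintro e _ h1 h2
      exact src_ne_tgt e e (h1.trans h2.symm)
  have hor : ∀ v, #{e ∈ S | src e = v} = 0 ∨ #{e ∈ S | tgt e = v} = 0 := by
    intro v
    by_contra hcon
    push Not at hcon
    obtain ⟨⟨e, he⟩, ⟨f, hf⟩⟩ := hcon.imp card_ne_zero.mp card_ne_zero.mp
    exact src_ne_tgt e f ((mem_filter.mp he).2.trans (mem_filter.mp hf).2.symm)
  rw [OrderedDigraph.mem_evenSets, ← forall_and]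
  refine forall_congr' fun v => ?_
  rw [hcard]
  rcases hor v with h | h <;> simp [h]

theorem blockKey_convex {ι V : Type} {code : V → ℕ} (hcode : Function.Injective code) (b : ι → V)
    (w : Bool) (ρ : Fin 4) (δ : ι → Fin 4) (i j k : ι) (hij : b i = b j) (hk : b k ≠ b i) :
    blockKey code b w ρ δ k < blockKey code b w ρ δ i ↔
      blockKey code b w ρ δ k < blockKey code b w ρ δ j := by
  rw [blockKey_lt_iff_of_ne hcode w ρ δ hk, blockKey_lt_iff_of_ne hcode w ρ δ (hij ▸ hk), hij]

theorem det_squareLattice (hrs : Odd (r.val + s.val)) (v : ℂ) :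
    (1 - v ^ 2 • ((squareLattice m n c cw r s).tgtSign *
      (squareLattice m n c cw r s).srcSign)).det = (squareLattice m n c cw r s).evenSum v ^ 2 := by
  rw [srcSign_squareLattice, tgtSign_squareLattice,
    det_blockSign_eq_sq (srcKey_injective cw r) (tgtKey_injective cw s) src tgt
      (blockKey_convex siteCode_injective src cw r dir)
      (blockKey_convex siteCode_injective tgt (!cw) s _)
      (fun S => inversionSign_eq_one cw r s hrs), OrderedDigraph.evenSum_eq]
  congr 1
  refine sum_congr ?_ fun _ _ => rfl
  ext S
  rw [mem_evenSets_squareLattice]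
  simp

end SquareLattice

theorem theorem2 (m n : ℕ) (c : Fin 2) (cw : Bool) (r s : Fin 4) (hrs : Odd (r.val + s.val)) :
    -- the Gaussian integral converges at least in the disc `|v| < √2 - 1`
    (∀ v : ℂ, ‖v‖ < Real.sqrt 2 - 1 →
      (squareLattice m n c cw r s).Converges
        ((squareLattice m n c cw r s).homWeight (Complex.I * v))) ∧
    -- wherever it converges, `𝒢(iv) = (1 + ∑_P g_P v^P)⁻²`
    (∀ v : ℂ,
      (squareLattice m n c cw r s).Converges
        ((squareLattice m n c cw r s).homWeight (Complex.I * v)) →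
      (squareLattice m n c cw r s).evenSum v ≠ 0 ∧
      (squareLattice m n c cw r s).genFun
          ((squareLattice m n c cw r s).homWeight (Complex.I * v)) =
        ((squareLattice m n c cw r s).evenSum v ^ 2)⁻¹) ∧
    -- and in terms of the Ising partition function, with `v = tanh K`, `K = βJ`
    (∀ K : ℝ,
      (squareLattice m n c cw r s).Converges
        ((squareLattice m n c cw r s).homWeight (Complex.I * (Real.tanh K : ℂ))) →
      (squareLattice m n c cw r s).genFun
          ((squareLattice m n c cw r s).homWeight (Complex.I * (Real.tanh K : ℂ))) =
        (2 : ℂ) ^ (2 * (m * n)) /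
          ((1 - (Real.tanh K : ℂ) ^ 2) ^ (m * (n - 1) + n * (m - 1)) *
            ((squareLattice m n c cw r s).isingZ K : ℂ) ^ 2)) := by
  have hconv : ∀ v : ℂ, (squareLattice m n c cw r s).Converges
      ((squareLattice m n c cw r s).homWeight (Complex.I * v)) →
      (squareLattice m n c cw r s).evenSum v ≠ 0 ∧
      (squareLattice m n c cw r s).genFun
          ((squareLattice m n c cw r s).homWeight (Complex.I * v)) =
        ((squareLattice m n c cw r s).evenSum v ^ 2)⁻¹ := by
    intro v hv
    have h := (squareLattice_alternating cw r s).genFun_eq v hv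
    rw [det_squareLattice cw r s hrs] at h
    exact ⟨fun h0 => h.1 (by rw [h0, zero_pow two_ne_zero]), h.2⟩
  refine ⟨fun v hv => ?_, hconv, fun K hK => ?_⟩
  · refine (squareLattice_alternating cw r s).converges
      (fun e => (rank_src cw r s e).trans_lt (cyclicRank_lt _ _ _))
      (fun e => (rank_tgt cw r s e).trans_lt (cyclicRank_lt _ _ _)) ?_
    rwa [norm_mul, Complex.norm_I, one_mul]
  · obtain ⟨hne, hgen⟩ := hconv _ hK
    have hc : (Real.cosh K : ℂ) ≠ 0 := by exact_mod_cast (Real.cosh_pos K).ne'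
    have hZ : ((squareLattice m n c cw r s).isingZ K : ℂ) =
        (Real.cosh K : ℂ) ^ (m * (n - 1) + n * (m - 1)) *
          (2 ^ (m * n) * (squareLattice m n c cw r s).evenSum (Real.tanh K)) := by
      rw [OrderedDigraph.isingZ_eq, OrderedDigraph.evenSum_eq, card_latticeEdge,
        Fintype.card_prod, Fintype.card_fin, Fintype.card_fin]
      push_cast
      rfl
    -- This turns the power of `1 - v²` into `cosh K ^ (-2E)`, which cancels the prefactor of `Z²`.
    have hv : 1 - (Real.tanh K : ℂ) ^ 2 = ((Real.cosh K : ℂ) ^ 2)⁻¹ := by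
      have h := Real.cosh_sq K
      rw [Real.tanh_eq_sinh_div_cosh, Complex.ofReal_div]
      field_simp
      have h' : (Real.cosh K : ℂ) ^ 2 = (Real.sinh K : ℂ) ^ 2 + 1 := by exact_mod_cast h
      rw [h']
      ring
    rw [hgen, hZ, hv]
    field_simp
    rw [one_div, inv_pow, div_inv_eq_mul]
    generalize m * (n - 1) + n * (m - 1) = N
    ring
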